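/- Let $\mathscr H$ be a real or complex Hilbert space and $\mathbf H$ a (possibly unbounded) self-adjoint operator on $\mathscr H$ with spectral resolution $P$ (a projection-valued measure on $\mathbb R$ with $\mathbf H=\int E\,dP(E)$; point and continuous spectrum are both allowed). Let $v_1,\dots,v_M\in\operatorname{dom}\mathbf H$ and let $\mathbf V x=\sum_l x_l v_l$. For a Borel set $I\subseteq\mathbb R$ let $\mathbf V I=P(I)\mathbf V$, and for any such $\mathbf W$ write $\mathbf W^2=\mathbf W^\dagger \mathbf W$ for the Gram matrix and $\lambda_1(\mathbf W^2)\ge\lambda_2(\mathbf W^2)\ge\cdots$ for its eigenvalues. Let $m=\operatorname{rank}\mathbf V^2$. The proper eigenvalues $\mu_1(\mathbf V)\ge\dots\ge\mu_m(\mathbf V)$ of the generalized eigenvalue problem (GEP) $\mathbf V^\dagger\mathbf H\mathbf V x=\mu\,\mathbf V^\dagger\mathbf V x$ are those with eigenvectors outside $\ker\mathbf V$, with multiplicity; $\mu_i(\mathbf V):=0$ for $i>m$ (and likewise for other guess vectors). The spectral measure $|\alpha(E)|^2dE$ of the GEP is the measure $I\mapsto\operatorname{Tr}[(\mathbf V I)^2]=\sum_l\|P(I)v_l\|^2$.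 Let $E_a<E_b$, $\mathbf B=\mathbf V(E_a,E_b)$ and $\mathbf N=\mathbf V-\mathbf B$. Integrals $\int_{E_b}^\infty$ and $\int_{-\infty}^{E_a}$ are over the closed half-lines $[E_b,\infty)$ and $(-\infty,E_a]$. The GEP is a \emph{signal} to $(E_a,E_b)$ if $$\int_{E_b}^{\infty}\frac{|\alpha(E)|^2}{\lambda_{*}(\mathbf V(-\infty,E)^2)}dE\le1,\qquad \int_{-\infty}^{E_a}\frac{|\alpha(E)|^2}{\lambda_{*}(\mathbf V(E,\infty)^2)}dE\le1,$$ where $\lambda_*$ denotes the smallest non-zero eigenvalue ($\lambda_*=0$ for the zero matrix, with $1/0=\infty$). A signal is \emph{certifiable} if the quotients $$\frac{\int_{E_b}^\infty|\alpha(E)|^2dE}{\lambda_m(\mathbf V^2)-\lambda_1(\mathbf V[E_b,\infty)^2)},\qquad \frac{\int_{-\infty}^{E_a}|\alpha(E)|^2dE}{\lambda_m(\mathbf V^2)-\lambda_1(\mathbf V(-\infty,E_a]^2)}$$ are well defined (non-zero denominators) and lie in $[0,1]$. (i) If the GEP is a certifiable signal to $(E_a,E_b)$, then for all $1\le i\le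 m$ the integrals below converge and $$\frac{\int_{-\infty}^{E_a}(E-\mu_i(\mathbf B))|\alpha(E)|^2dE}{\lambda_m(\mathbf V^2)-\lambda_1(\mathbf V(-\infty,E_a]^2)}\ \le\ \mu_i(\mathbf V)-\mu_i(\mathbf B)\ \le\ \frac{\int_{E_b}^{\infty}(E-\mu_i(\mathbf B))|\alpha(E)|^2dE}{\lambda_m(\mathbf V^2)-\lambda_1(\mathbf V[E_b,\infty)^2)}.$$ (ii) If $\mathbf V\ne0$ and $\lambda_m(\mathbf V^2)\ge(m+1)\lambda_1(\mathbf N^2)$, then the GEP is a certifiable signal to $(E_a,E_b)$. (iii) (Guarantee R3.) Let $\mathcal E$ be the span of all eigenvectors of $\mathbf H$ with eigenvalues in $(E_a,E_b)$ and suppose that $\mathcal E=\operatorname{ran}P(E_a,E_b)$ (there is no continuous spectrum in the interval). Let $\varepsilon>\lambda_1(\mathbf N^2)$, let $\mathbf U=[u_1,\dots,u_M]$ be unitary with $\mathbf U^\dagger\mathbf V^2\mathbf U=\operatorname{diag}(\lambda_1(\mathbf V^2),\dots,\lambda_M(\mathbf V^2))$, and let $d$ be the number of eigenvalues of $\mathbf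 V^2$ (with multiplicity) that are at least $\varepsilon$. Let $\mathbf V_*=[\mathbf Vu_1,\dots,\mathbf Vu_d]$, with noise $\mathbf N_*=\mathbf V_*-\mathbf V_*(E_a,E_b)$ and spectral measure $|\alpha_*(E)|^2dE$. If $d=\dim\mathcal E$ and $\lambda_d(\mathbf V^2)\ge(d+1)\lambda_1(\mathbf N^2)$, then, with $\lambda_1\ge\dots\ge\lambda_d$ the eigenvalues of $\mathbf H$ in $\mathcal E$ counted with multiplicity, for all $1\le i\le d$ the integrals below converge and $$\frac{\int_{-\infty}^{E_a}(E-\lambda_i)|\alpha_*(E)|^2dE}{\lambda_d(\mathbf V^2)-\lambda_1(\mathbf N^2)}\ \le\ \mu_i(\mathbf V_*)-\lambda_i\ \le\ \frac{\int_{E_b}^{\infty}(E-\lambda_i)|\alpha_*(E)|^2dE}{\lambda_d(\mathbf V^2)-\lambda_1(\mathbf N^2)},$$ and $\int_{-\infty}^{E_a}|\alpha_*(E)|^2dE+\int_{E_b}^\infty|\alpha_*(E)|^2dE=\operatorname{Tr}[\mathbf N_*^2]\le d\,\lambda_1(\mathbf N^2)$. -/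

import Mathlib

open MeasureTheory Matrix
open scoped ENNReal InnerProductSpace

noncomputable section

namespace GEP

/-- A projection-valued measure on the Borel sets of `ℝ`, acting on the Hilbert space `ℋ`:
a resolution of the identity. -/
structure ProjValuedMeasure (𝕜 ℋ : Type*) [RCLike 𝕜] [NormedAddCommGroup ℋ]
    [InnerProductSpace 𝕜 ℋ] [CompleteSpace ℋ] where
  proj : Set ℝ → (ℋ →L[𝕜] ℋ)
  isStarProjection : ∀ S, MeasurableSet S → IsStarProjection (proj S)
  empty : proj ∅ = 0
  univ : proj Set.univ = 1
  inter : ∀ S T, MeasurableSet S → MeasurableSet T → proj (S ∩ T) = proj S * proj T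
  iUnion : ∀ S : ℕ → Set ℝ, (∀ n, MeasurableSet (S n)) → Pairwise (Function.onFun Disjoint S) →
    ∀ x, HasSum (fun n => proj (S n) x) (proj (⋃ n, S n) x)

variable {𝕜 ℋ : Type*} [RCLike 𝕜] [NormedAddCommGroup ℋ] [InnerProductSpace 𝕜 ℋ]
  [CompleteSpace ℋ] {M : ℕ}

theorem ProjValuedMeasure.norm_sq_eq (P : ProjValuedMeasure 𝕜 ℋ) {S : Set ℝ}
    (hS : MeasurableSet S) (x : ℋ) : ‖P.proj S x‖ ^ 2 = RCLike.re (inner 𝕜 x (P.proj S x)) := by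
  have h := P.isStarProjection S hS
  have hid : P.proj S (P.proj S x) = P.proj S x := by
    have := congrArg (fun T : ℋ →L[𝕜] ℋ => T x) h.isIdempotentElem.eq
    simpa using this
  have hsa := h.isSelfAdjoint
  rw [ContinuousLinearMap.isSelfAdjoint_iff_isSymmetric] at hsa
  have h2 : inner 𝕜 (P.proj S x) (P.proj S x) = inner 𝕜 x (P.proj S (P.proj S x)) :=
    hsa x (P.proj S x)
  rw [← inner_self_eq_norm_sq (𝕜 := 𝕜), h2, hid]

/-- The scalar measure `S ↦ ‖P(S) x‖² = ⟨x, P(S) x⟩`. -/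
def ProjValuedMeasure.measure (P : ProjValuedMeasure 𝕜 ℋ) (x : ℋ) : Measure ℝ :=
  Measure.ofMeasurable (fun S _ => ENNReal.ofReal (‖P.proj S x‖ ^ 2)) (by simp [P.empty]) (by
    intro S hS hd
    have hs : HasSum (fun n => ‖P.proj (S n) x‖ ^ 2) (‖P.proj (⋃ n, S n) x‖ ^ 2) := by
      rw [P.norm_sq_eq (MeasurableSet.iUnion hS)]
      simp_rw [fun n => P.norm_sq_eq (hS n) x]
      exact ((P.iUnion S hS hd x).mapL (innerSL 𝕜 x)).mapL (RCLike.reCLM (K := 𝕜))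
    rw [← hs.tsum_eq, ENNReal.ofReal_tsum_of_nonneg (fun n => by positivity) hs.summable])

theorem ProjValuedMeasure.measure_apply (P : ProjValuedMeasure 𝕜 ℋ) (x : ℋ) {S : Set ℝ}
    (hS : MeasurableSet S) : P.measure x S = ENNReal.ofReal (‖P.proj S x‖ ^ 2) :=
  Measure.ofMeasurable_apply S hS

theorem ProjValuedMeasure.measure_proj (P : ProjValuedMeasure 𝕜 ℋ) (x : ℋ) {S : Set ℝ}
    (hS : MeasurableSet S) : P.measure (P.proj S x) = (P.measure x).restrict S := by
  ext T hT
  rw [Measure.restrict_apply hT, P.measure_apply _ hT, P.measure_apply _ (hT.inter hS),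
    P.inter T S hT hS]
  rfl

/-- `P` is the spectral resolution of the (possibly unbounded) operator `H`, that is
`H = ∫ E dP(E)`: the domain of `H` consists of the `x` with `∫ E² d⟨x, P(E) x⟩ < ∞`, and
`⟨x, H x⟩ = ∫ E d⟨x, P(E) x⟩` on it. -/
structure IsSpectralResolution (H : ℋ →ₗ.[𝕜] ℋ) (P : ProjValuedMeasure 𝕜 ℋ) : Prop where
  mem_domain_iff : ∀ x, x ∈ H.domain ↔ ∫⁻ E, ENNReal.ofReal (E ^ 2) ∂P.measure x < ∞
  inner_apply : ∀ x : H.domain,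
    inner 𝕜 (x : ℋ) (H x) = ((∫ E, E ∂P.measure (x : ℋ) : ℝ) : 𝕜)

theorem IsSpectralResolution.proj_mem {H : ℋ →ₗ.[𝕜] ℋ} {P : ProjValuedMeasure 𝕜 ℋ}
    (hP : IsSpectralResolution H P) {S : Set ℝ} (hS : MeasurableSet S) {x : ℋ}
    (hx : x ∈ H.domain) : P.proj S x ∈ H.domain := by
  rw [hP.mem_domain_iff] at hx ⊢
  rw [P.measure_proj x hS]
  exact (lintegral_mono' Measure.restrict_le_self le_rfl).trans_lt hx

/-- The guess vectors `V I` projected onto the spectral subspace of a set `I` of energies. -/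
def restrictTo (P : ProjValuedMeasure 𝕜 ℋ) (I : Set ℝ) (v : Fin M → ℋ) : Fin M → ℋ :=
  fun l => P.proj I (v l)

/-- The signal part `B = V(E_a, E_b)` of guess vectors in the domain of `H`. -/
def signal {H : ℋ →ₗ.[𝕜] ℋ} {P : ProjValuedMeasure 𝕜 ℋ} (hP : IsSpectralResolution H P)
    (Ea Eb : ℝ) (v : Fin M → H.domain) : Fin M → H.domain :=
  fun l => ⟨P.proj (Set.Ioo Ea Eb) (v l), hP.proj_mem measurableSet_Ioo (v l).2⟩

/-- The noise part `N = V - B`. -/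
def noise (P : ProjValuedMeasure 𝕜 ℋ) (Ea Eb : ℝ) (v : Fin M → ℋ) : Fin M → ℋ :=
  fun l => v l - P.proj (Set.Ioo Ea Eb) (v l)

variable (𝕜) in
/-- `λ_k(V²)`: the `k`-th largest eigenvalue (`k = 1, …, M`, with multiplicity) of the Gram
matrix `V² = V†V` of the guess vectors, and `0` for all other `k`. -/
def gramEig (v : Fin M → ℋ) (k : ℕ) : ℝ :=
  if h : 1 ≤ k ∧ k ≤ M then
    (isHermitian_gram 𝕜 v).eigenvalues₀ ⟨k - 1, by rw [Fintype.card_fin]; omega⟩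
  else 0

variable (𝕜) in
/-- The rank of the Gram matrix `V²`. -/
def gramRank (v : Fin M → ℋ) : ℕ := (gram 𝕜 v).rank

variable (𝕜) in
/-- `λ_{m*}(V²)`: the smallest non-zero eigenvalue of the Gram matrix (`0` if `V = 0`). -/
def lowestGramEig (v : Fin M → ℋ) : ℝ := gramEig 𝕜 v (gramRank 𝕜 v)

/-- The spectral measure `|α(E)|² dE` of the guess vectors: the measure
`I ↦ Tr[(V I)²] = ∑ l, ‖P(I) v_l‖²`. -/
def specMeasure (P : ProjValuedMeasure 𝕜 ℋ) (v : Fin M → ℋ) : Measure ℝ :=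
  ∑ l, P.measure (v l)

/-- The matrix `V† H V`. -/
def projMatrix (H : ℋ →ₗ.[𝕜] ℋ) (v : Fin M → H.domain) : Matrix (Fin M) (Fin M) 𝕜 :=
  Matrix.of fun i j => inner 𝕜 (v i : ℋ) (H (v j))

/-- The Gram matrix `V†V` of guess vectors in the domain of `H`. -/
def gramMatrix (H : ℋ →ₗ.[𝕜] ℋ) (v : Fin M → H.domain) : Matrix (Fin M) (Fin M) 𝕜 :=
  gram 𝕜 fun l => (v l : ℋ)

/-- `μ` is the list of proper eigenvalues of the GEP `V†HV x = μ V†V x`, in descending order and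
with multiplicity: there are as many as the rank of `V†V`, with `V†V`-orthonormal eigenvectors. -/
def IsProperSpectrum (H : ℋ →ₗ.[𝕜] ℋ) (v : Fin M → H.domain)
    (μ : Fin (gramRank 𝕜 fun l => (v l : ℋ)) → ℝ) : Prop :=
  Antitone μ ∧ ∃ x : Fin (gramRank 𝕜 fun l => (v l : ℋ)) → Fin M → 𝕜,
    (∀ i, projMatrix H v *ᵥ x i = (μ i : 𝕜) • (gramMatrix H v *ᵥ x i)) ∧
    ∀ i j, star (x i) ⬝ᵥ (gramMatrix H v *ᵥ x j) = if i = j then 1 else 0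

theorem gram_mulVec (v : Fin M → ℋ) (x : Fin M → 𝕜) (i : Fin M) :
    (gram 𝕜 v *ᵥ x) i = inner 𝕜 (v i) (∑ l, x l • v l) := by
  simp [mulVec, dotProduct, inner_sum, inner_smul_right, gram_apply, mul_comm]

theorem star_dotProduct_gram (v : Fin M → ℋ) (x y : Fin M → 𝕜) :
    star x ⬝ᵥ (gram 𝕜 v *ᵥ y) = inner 𝕜 (∑ l, x l • v l) (∑ l, y l • v l) := by
  simp only [dotProduct, gram_mulVec, sum_inner, inner_smul_left, Pi.star_apply, RCLike.star_def]

theorem gramRank_eq (v : Fin M → ℋ) :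
    gramRank 𝕜 v = Module.finrank 𝕜 (Submodule.span 𝕜 (Set.range v)) := by
  have hker : LinearMap.ker (gram 𝕜 v).mulVecLin = LinearMap.ker (Fintype.linearCombination 𝕜 v) := by
    ext x
    simp only [LinearMap.mem_ker, mulVecLin_apply, Fintype.linearCombination_apply]
    constructor
    · intro h
      have h2 := star_dotProduct_gram v x x
      rw [h, dotProduct_zero] at h2
      exact inner_self_eq_zero.1 h2.symm
    · intro h
      ext i
      rw [gram_mulVec, h]
      simp
  have h1 := LinearMap.finrank_range_add_finrank_ker (gram 𝕜 v).mulVecLin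
  have h2 := LinearMap.finrank_range_add_finrank_ker (Fintype.linearCombination 𝕜 v)
  rw [hker] at h1
  rw [Fintype.range_linearCombination] at h2
  unfold gramRank Matrix.rank
  omega

/-- The generalized spectral theorem: the proper eigenvalues exist. -/
theorem exists_isProperSpectrum {H : ℋ →ₗ.[𝕜] ℋ} (hH : IsSelfAdjoint H) (v : Fin M → H.domain) :
    ∃ μ, IsProperSpectrum H v μ := by
  classical
  have hsymm : ∀ x y : H.domain, inner 𝕜 (H x) (y : ℋ) = inner 𝕜 (x : ℋ) (H y) := by
    have h := LinearPMap.adjoint_isFormalAdjoint hH.dense_domain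
    rw [LinearPMap.isSelfAdjoint_def.1 hH] at h
    exact h
  set w : Fin M → ℋ := fun l => (v l : ℋ) with hw
  set W : Submodule 𝕜 ℋ := Submodule.span 𝕜 (Set.range w) with hW
  have hWd : W ≤ H.domain := by
    rw [hW, Submodule.span_le]
    rintro _ ⟨l, rfl⟩
    exact (v l).2
  have : FiniteDimensional 𝕜 W := FiniteDimensional.span_of_finite 𝕜 (Set.finite_range w)
  let T : W →ₗ[𝕜] W :=
    (W.orthogonalProjectionOnto : ℋ →ₗ[𝕜] W) ∘ₗ H.toFun ∘ₗ Submodule.inclusion hWd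
  have hTapp : ∀ (z y : W), inner 𝕜 (z : ℋ) ((T y : W) : ℋ) =
      inner 𝕜 (z : ℋ) (H (Submodule.inclusion hWd y)) := by
    intro z y
    have : ((T y : W) : ℋ) = W.starProjection (H (Submodule.inclusion hWd y)) := rfl
    rw [this, ← Submodule.inner_starProjection_left_eq_right]
    rw [Submodule.starProjection_eq_self_iff.2 z.2]
  have hT : T.IsSymmetric := by
    intro y z
    have h1 := hTapp y z
    have h2 := hTapp z y
    rw [Submodule.coe_inner, Submodule.coe_inner, h1, ← inner_conj_symm, h2, inner_conj_symm]
    exact hsymm (Submodule.inclusion hWd y) (Submodule.inclusion hWd z)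
  have hn : Module.finrank 𝕜 W = gramRank 𝕜 w := (gramRank_eq w).symm
  have hex : ∀ i, ∃ x : Fin M → 𝕜, ∑ l, x l • w l = (hT.eigenvectorBasis hn i : ℋ) := by
    intro i
    have hmem : (hT.eigenvectorBasis hn i : ℋ) ∈
        LinearMap.range (Fintype.linearCombination 𝕜 w) := by
      rw [Fintype.range_linearCombination]
      exact (hT.eigenvectorBasis hn i).2
    obtain ⟨x, hx⟩ := hmem
    exact ⟨x, by simpa [Fintype.linearCombination_apply] using hx⟩
  choose x hx using hex
  refine ⟨hT.eigenvalues hn, hT.eigenvalues_antitone hn, x, ?_, ?_⟩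
  · intro i
    ext k
    have hsum : (∑ l, x i l • v l : H.domain) =
        Submodule.inclusion hWd (hT.eigenvectorBasis hn i) := by
      apply Subtype.ext
      rw [Submodule.coe_inclusion, ← hx i]
      simp [hw]
    have hL : (projMatrix H v *ᵥ x i) k = inner 𝕜 (w k) (H (∑ l, x i l • v l)) := by
      have : H (∑ l, x i l • v l) = ∑ l, x i l • H (v l) := by
        change H.toFun _ = _
        rw [map_sum]
        simp only [map_smul]
        rfl
      rw [this]
      simp [mulVec, dotProduct, inner_sum, inner_smul_right, projMatrix, mul_comm, hw]
    have hk : w k ∈ W := Submodule.subset_span ⟨k, rfl⟩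
    have h3 := hTapp ⟨w k, hk⟩ (hT.eigenvectorBasis hn i)
    rw [hT.apply_eigenvectorBasis hn i] at h3
    rw [hL, hsum, ← h3, Pi.smul_apply]
    have h4 : (gramMatrix H v *ᵥ x i) k = inner 𝕜 (w k) (∑ l, x i l • w l) := gram_mulVec w (x i) k
    rw [h4, hx i, Submodule.coe_smul, inner_smul_right, smul_eq_mul]
  · intro i j
    have h5 : star (x i) ⬝ᵥ (gramMatrix H v *ᵥ x j) =
      inner 𝕜 (∑ l, x i l • w l) (∑ l, x j l • w l) := star_dotProduct_gram w (x i) (x j)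
    rw [h5, hx i, hx j, ← Submodule.coe_inner]
    exact orthonormal_iff_ite.1 (hT.eigenvectorBasis hn).orthonormal i j

/-- `μ_k(V)`: the `k`-th largest proper eigenvalue of the GEP `(H, V)` for `k = 1, …, rank V²`.
The spurious eigenvalues (all other `k`) are set to zero. -/
def genEig {H : ℋ →ₗ.[𝕜] ℋ} (hH : IsSelfAdjoint H) (v : Fin M → H.domain) (k : ℕ) : ℝ :=
  if h : 1 ≤ k ∧ k ≤ gramRank 𝕜 (fun l => (v l : ℋ)) then
    (exists_isProperSpectrum hH v).choose ⟨k - 1, by omega⟩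
  else 0

/-- The GEP is a signal to `(E_a, E_b)`:
`∫_{E_b}^∞ |α(E)|² / λ_{m*}(V(-∞,E)²) dE ≤ 1` and
`∫_{-∞}^{E_a} |α(E)|² / λ_{m*}(V(E,∞)²) dE ≤ 1` (with `1 / 0 = ∞`). -/
def IsSignal (P : ProjValuedMeasure 𝕜 ℋ) (Ea Eb : ℝ) (v : Fin M → ℋ) : Prop :=
  ∫⁻ E in Set.Ici Eb, (ENNReal.ofReal (lowestGramEig 𝕜 (restrictTo P (Set.Iio E) v)))⁻¹
      ∂specMeasure P v ≤ 1 ∧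
  ∫⁻ E in Set.Iic Ea, (ENNReal.ofReal (lowestGramEig 𝕜 (restrictTo P (Set.Ioi E) v)))⁻¹
      ∂specMeasure P v ≤ 1

/-- `λ_m(V²) - λ_1(V[E_b,∞)²)`, where `m` is the rank of `V²`. -/
def upperGap (P : ProjValuedMeasure 𝕜 ℋ) (Eb : ℝ) (v : Fin M → ℋ) : ℝ :=
  gramEig 𝕜 v (gramRank 𝕜 v) - gramEig 𝕜 (restrictTo P (Set.Ici Eb) v) 1

/-- `λ_m(V²) - λ_1(V(-∞,E_a]²)`, where `m` is the rank of `V²`. -/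
def lowerGap (P : ProjValuedMeasure 𝕜 ℋ) (Ea : ℝ) (v : Fin M → ℋ) : ℝ :=
  gramEig 𝕜 v (gramRank 𝕜 v) - gramEig 𝕜 (restrictTo P (Set.Iic Ea) v) 1

/-- The GEP is a certifiable signal to `(E_a, E_b)`: a signal for which the two quotients below
are well defined and lie in `[0, 1]`. -/
structure IsCertifiable (P : ProjValuedMeasure 𝕜 ℋ) (Ea Eb : ℝ) (v : Fin M → ℋ) : Prop where
  isSignal : IsSignal P Ea Eb v
  upper_ne : upperGap P Eb v ≠ 0
  upper_mem : (specMeasure P v).real (Set.Ici Eb) / upperGap P Eb v ∈ Set.Icc (0 : ℝ) 1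
  lower_ne : lowerGap P Ea v ≠ 0
  lower_mem : (specMeasure P v).real (Set.Iic Ea) / lowerGap P Ea v ∈ Set.Icc (0 : ℝ) 1

/-- The span of all eigenvectors of `H` with eigenvalues in `(E_a, E_b)`. -/
def eigenSubspace (H : ℋ →ₗ.[𝕜] ℋ) (Ea Eb : ℝ) : Submodule 𝕜 ℋ :=
  Submodule.span 𝕜
    {φ | ∃ (x : H.domain) (t : ℝ), t ∈ Set.Ioo Ea Eb ∧ H x = (t : 𝕜) • (x : ℋ) ∧ (x : ℋ) = φ}

variable (𝕜) in
/-- The number of eigenvalues of the Gram matrix that are at least `ε`: the detected dimension. -/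
def detectedDim (v : Fin M → ℋ) (ε : ℝ) : ℕ :=
  (Finset.univ.filter fun j : Fin M => ε ≤ gramEig 𝕜 v (j + 1)).card

theorem detectedDim_le (v : Fin M → ℋ) (ε : ℝ) : detectedDim 𝕜 v ε ≤ M :=
  (Finset.card_le_univ _).trans_eq (Fintype.card_fin M)

/-- The matrix `U` diagonalizes the Gram matrix with eigenvalues in descending order. -/
def Diagonalizes (v : Fin M → ℋ) (U : Matrix (Fin M) (Fin M) 𝕜) : Prop :=
  U ∈ Matrix.unitaryGroup (Fin M) 𝕜 ∧
    Uᴴ * gram 𝕜 v * U = Matrix.diagonal fun j : Fin M => ((gramEig 𝕜 v (j + 1) : ℝ) : 𝕜)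

/-- The refined guess vectors `V u_1, …, V u_d`, where `u_j` are the columns of `U` and `d` is
the detected dimension. -/
def refined {H : ℋ →ₗ.[𝕜] ℋ} (v : Fin M → H.domain) (U : Matrix (Fin M) (Fin M) 𝕜) (ε : ℝ) :
    Fin (detectedDim 𝕜 (fun l => (v l : ℋ)) ε) → H.domain :=
  fun j => ∑ l, U l (Fin.castLE (detectedDim_le _ _) j) • v l

end GEP

end

/-! The noise bounds come from the scalar spectral measures `ρ_y(I) = ‖P(I) y‖²`, for which
`⟪y, (H - c) y⟫ = ∫ (E - c) dρ_y`. A Courant–Fischer dimension count gives a nonzero `y` in the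
range of `V` that lies in the span of the first `i` Ritz vectors of `V` and whose signal part is
orthogonal to the first `i - 1` Ritz vectors of `B`. Take `c = μ_i(B)`, which lies in `[E_a, E_b]`:
the left side is at least `(μ_i(V) - c) ‖y‖²`, while `(-∞, E_a]` and `(E_a, E_b)` contribute at most
`0`, so only the integral over `[E_b, ∞)` remains. Let `g` be the denominator
`λ_m(V²) - λ₁(V[E_b, ∞)²)`. Writing `y = V x` with `g ‖x‖² ≤ ‖y‖²`, Cauchy–Schwarz gives
`g ρ_y ≤ ‖y‖² |α|²`, which replaces `ρ_y` by the spectral measure of the problem. The lower bound is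
the mirror image.

If `i > rank B`, there is no `μ_i(B)` to compare with, but then some nonzero vector in the range of
`V` is annihilated by `P(E_a, E_b)`. Its norm is split between the two half-lines, which forces both
certificate quotients to equal `1`, and the constant `c` cancels from the inequalities.

The signal condition follows from the certificate quotients because
`λ_*(V(-∞, E)²) ≥ λ_m(V²) - λ₁(V[E_b, ∞)²)` for `E ≥ E_b`. -/

namespace GEP

section FrameBound

variable {𝕜 E ι : Type*} [RCLike 𝕜] [NormedAddCommGroup E] [InnerProductSpace 𝕜 E] [Fintype ι]

theorem exists_mem_ne_zero_forall_inner_eq_zero (W : Submodule 𝕜 E) (z : ι → E)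
    (h : Fintype.card ι < Module.finrank 𝕜 W) :
    ∃ y ∈ W, y ≠ 0 ∧ ∀ i, inner 𝕜 (z i) y = 0 := by
  have : FiniteDimensional 𝕜 W := Module.finite_of_finrank_pos (Nat.zero_lt_of_lt h)
  let f : W →ₗ[𝕜] ι → 𝕜 := LinearMap.pi fun i => innerₛₗ 𝕜 (z i) ∘ₗ W.subtype
  have hf : LinearMap.ker f ≠ ⊥ := LinearMap.ker_ne_bot_of_finrank_lt (by simpa using h)
  obtain ⟨y, hy, hy0⟩ := Submodule.exists_mem_ne_zero_of_ne_bot hf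
  exact ⟨y, y.2, by simpa using hy0, fun i => congrFun hy i⟩

theorem norm_sum_sq_of_pairwise_orthogonal {z : ι → E}
    (hz : Pairwise fun i j => inner 𝕜 (z i) (z j) = 0) : ‖∑ i, z i‖ ^ 2 = ∑ i, ‖z i‖ ^ 2 := by
  have hinner (i : ι) : inner 𝕜 (z i) (∑ j, z j) = inner 𝕜 (z i) (z i) := by
    rw [inner_sum]
    exact Fintype.sum_eq_single i fun j hj => hz hj.symm
  simp only [← inner_self_eq_norm_sq (𝕜 := 𝕜), sum_inner, hinner, map_sum]

variable (𝕜) in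
/-- The synthesis operator `x ↦ ∑ l, x l • v l` of a finite family of vectors: the operator `𝐕`
of guess vectors `v`, on coordinates with the Euclidean norm. -/
noncomputable def synthesis (v : ι → E) : EuclideanSpace 𝕜 ι →ₗ[𝕜] E :=
  Fintype.linearCombination 𝕜 v ∘ₗ (WithLp.linearEquiv 2 𝕜 (ι → 𝕜)).toLinearMap

theorem synthesis_apply (v : ι → E) (x : EuclideanSpace 𝕜 ι) :
    synthesis 𝕜 v x = ∑ l, x l • v l :=
  rfl

theorem synthesis_single [DecidableEq ι] (v : ι → E) (l : ι) :
    synthesis 𝕜 v (EuclideanSpace.single l 1) = v l := by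
  simp [synthesis_apply]

theorem mem_span_range_iff_exists_synthesis {v : ι → E} {y : E} :
    y ∈ Submodule.span 𝕜 (Set.range v) ↔ ∃ x, synthesis 𝕜 v x = y := by
  rw [Submodule.mem_span_range_iff_exists_fun]
  exact (WithLp.equiv 2 (ι → 𝕜)).symm.exists_congr fun _ => Iff.rfl

theorem norm_synthesis_sq_le (v : ι → E) (x : EuclideanSpace 𝕜 ι) :
    ‖synthesis 𝕜 v x‖ ^ 2 ≤ ‖x‖ ^ 2 * ∑ l, ‖v l‖ ^ 2 := by
  calc ‖synthesis 𝕜 v x‖ ^ 2 ≤ (∑ l, ‖x l‖ * ‖v l‖) ^ 2 := by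
        gcongr
        exact (norm_sum_le _ _).trans_eq (Finset.sum_congr rfl fun l _ => norm_smul _ _)
    _ ≤ (∑ l, ‖x l‖ ^ 2) * ∑ l, ‖v l‖ ^ 2 := Finset.sum_mul_sq_le_sq_mul_sq _ _ _
    _ = ‖x‖ ^ 2 * ∑ l, ‖v l‖ ^ 2 := by rw [EuclideanSpace.norm_sq_eq]

variable (𝕜) in
/-- `g` is a lower frame bound of the family `v` on its span: every vector of the span has
coordinates `z` with `g ‖z‖² ≤ ‖∑ l, z l • v l‖²`. For `v ≠ 0` this says that the non-zero
eigenvalues of the Gram matrix are at least `g`; unlike an eigenvalue bound it is monotone in `g`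
and stable under perturbations of the family. -/
def IsLowerFrameBound (v : ι → E) (g : ℝ) : Prop :=
  ∀ x, ∃ z, synthesis 𝕜 v z = synthesis 𝕜 v x ∧ g * ‖z‖ ^ 2 ≤ ‖synthesis 𝕜 v z‖ ^ 2

namespace IsLowerFrameBound

variable {v w : ι → E} {g κ : ℝ}

theorem mono (hv : IsLowerFrameBound 𝕜 v g) (hκ : κ ≤ g) : IsLowerFrameBound 𝕜 v κ := by
  intro x
  obtain ⟨z, hz, hgz⟩ := hv x
  exact ⟨z, hz, (mul_le_mul_of_nonneg_right hκ (sq_nonneg _)).trans hgz⟩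

theorem of_pairwise_orthogonal (horth : Pairwise fun i j => inner 𝕜 (v i) (v j) = 0)
    (hg : ∀ j, g ≤ ‖v j‖ ^ 2) : IsLowerFrameBound 𝕜 v g := by
  refine fun x => ⟨x, rfl, ?_⟩
  have hx : ‖synthesis 𝕜 v x‖ ^ 2 = ∑ j, ‖x j • v j‖ ^ 2 := by
    rw [synthesis_apply]
    refine norm_sum_sq_of_pairwise_orthogonal (𝕜 := 𝕜) fun i j hij => ?_
    simp only [inner_smul_left, inner_smul_right, horth hij, mul_zero]
  rw [hx, EuclideanSpace.norm_sq_eq, Finset.mul_sum]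
  refine Finset.sum_le_sum fun j _ => ?_
  rw [norm_smul, mul_pow, mul_comm]
  exact mul_le_mul_of_nonneg_left (hg j) (sq_nonneg _)

theorem sub_of_norm_sq_le (hv : IsLowerFrameBound 𝕜 v g)
    (hker : ∀ x, synthesis 𝕜 v x = 0 → synthesis 𝕜 w x = 0)
    (hle : ∀ x, ‖synthesis 𝕜 v x‖ ^ 2 ≤ ‖synthesis 𝕜 w x‖ ^ 2 + κ * ‖x‖ ^ 2) :
    IsLowerFrameBound 𝕜 w (g - κ) := by
  intro x
  obtain ⟨z, hz, hgz⟩ := hv x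
  refine ⟨z, ?_, by linarith [hle z]⟩
  rw [← sub_eq_zero, ← map_sub] at hz ⊢
  exact hker _ hz

theorem eq_zero (hv : IsLowerFrameBound 𝕜 v g)
    (hle : ∀ x, ‖synthesis 𝕜 v x‖ ^ 2 ≤ κ * ‖x‖ ^ 2) (hκ : κ < g) : v = 0 := by
  classical
  ext l
  obtain ⟨z, hz, hgz⟩ := hv (EuclideanSpace.single l 1)
  have hz0 : z = 0 := by
    have : ‖z‖ ^ 2 ≤ 0 := by nlinarith [hle z, sq_nonneg ‖z‖]
    simpa using this
  rw [← synthesis_single (𝕜 := 𝕜) v l, ← hz, hz0, map_zero, Pi.zero_apply]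

end IsLowerFrameBound

end FrameBound

variable {𝕜 ℋ : Type*} [RCLike 𝕜] [NormedAddCommGroup ℋ] [InnerProductSpace 𝕜 ℋ]

section SpectralMeasure

variable [CompleteSpace ℋ]

namespace ProjValuedMeasure

variable (P : ProjValuedMeasure 𝕜 ℋ) {S T : Set ℝ}

instance isFiniteMeasure_measure (x : ℋ) : IsFiniteMeasure (P.measure x) :=
  ⟨by rw [P.measure_apply x MeasurableSet.univ]; exact ENNReal.ofReal_lt_top⟩

theorem measureReal_apply (x : ℋ) (hS : MeasurableSet S) :
    (P.measure x).real S = ‖P.proj S x‖ ^ 2 := by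
  rw [Measure.real, P.measure_apply x hS, ENNReal.toReal_ofReal (sq_nonneg _)]

theorem measureReal_univ (x : ℋ) : (P.measure x).real Set.univ = ‖x‖ ^ 2 := by
  rw [P.measureReal_apply x MeasurableSet.univ, P.univ, one_apply_eq_self]

theorem proj_proj (hS : MeasurableSet S) (hT : MeasurableSet T) (x : ℋ) :
    P.proj S (P.proj T x) = P.proj (S ∩ T) x := by
  rw [P.inter S T hS hT, mul_apply_eq_comp]

theorem proj_proj_self (hS : MeasurableSet S) (x : ℋ) : P.proj S (P.proj S x) = P.proj S x := by
  rw [P.proj_proj hS hS, Set.inter_self]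

theorem inner_proj_left (hS : MeasurableSet S) (x y : ℋ) :
    inner 𝕜 (P.proj S x) y = inner 𝕜 x (P.proj S y) :=
  (P.isStarProjection S hS).isSelfAdjoint.isSymmetric x y

theorem norm_sq_add_norm_sq_compl (hS : MeasurableSet S) (x : ℋ) :
    ‖P.proj S x‖ ^ 2 + ‖P.proj Sᶜ x‖ ^ 2 = ‖x‖ ^ 2 := by
  rw [← P.measureReal_apply x hS, ← P.measureReal_apply x hS.compl, ← P.measureReal_univ x]
  exact measureReal_add_measureReal_compl hS

theorem norm_sq_mono (hS : MeasurableSet S) (hT : MeasurableSet T) (h : S ⊆ T) (x : ℋ) :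
    ‖P.proj S x‖ ^ 2 ≤ ‖P.proj T x‖ ^ 2 := by
  rw [← P.measureReal_apply x hS, ← P.measureReal_apply x hT]
  exact measureReal_mono h

theorem sub_proj (hS : MeasurableSet S) (x : ℋ) : x - P.proj S x = P.proj Sᶜ x := by
  have h := P.norm_sq_add_norm_sq_compl hS (x - P.proj S x - P.proj Sᶜ x)
  simp only [map_sub, P.proj_proj hS hS, P.proj_proj hS hS.compl, P.proj_proj hS.compl hS,
    P.proj_proj hS.compl hS.compl, Set.inter_self, Set.inter_compl_self, Set.compl_inter_self,
    P.empty, _root_.zero_apply, sub_self, sub_zero, norm_zero] at h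
  simpa [sub_eq_zero] using h.symm

theorem norm_sq_compl_Ioo {Ea Eb : ℝ} (hE : Ea < Eb) (x : ℋ) :
    ‖P.proj (Set.Ioo Ea Eb)ᶜ x‖ ^ 2 =
      ‖P.proj (Set.Iic Ea) x‖ ^ 2 + ‖P.proj (Set.Ici Eb) x‖ ^ 2 := by
  have hcompl : (Set.Ioo Ea Eb)ᶜ = Set.Iic Ea ∪ Set.Ici Eb := by
    rw [← Set.Ioi_inter_Iio, Set.compl_inter, Set.compl_Ioi, Set.compl_Iio]
  rw [← P.measureReal_apply x measurableSet_Ioo.compl, hcompl,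
    measureReal_union (Set.Iic_disjoint_Ici.2 hE.not_ge) measurableSet_Ici,
    P.measureReal_apply x measurableSet_Iic, P.measureReal_apply x measurableSet_Ici]

end ProjValuedMeasure

section SpecMeasure

variable {M : ℕ} (P : ProjValuedMeasure 𝕜 ℋ) (v : Fin M → ℋ)

instance isFiniteMeasure_specMeasure : IsFiniteMeasure (specMeasure P v) := by
  unfold specMeasure
  infer_instance

theorem specMeasure_real_apply {S : Set ℝ} (hS : MeasurableSet S) :
    (specMeasure P v).real S = ∑ l, ‖P.proj S (v l)‖ ^ 2 := by
  rw [Measure.real, specMeasure, Measure.finsetSum_apply,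
    ENNReal.toReal_sum fun l _ => measure_ne_top _ _]
  exact Finset.sum_congr rfl fun l _ => P.measureReal_apply _ hS

theorem noise_eq_restrictTo (Ea Eb : ℝ) : noise P Ea Eb v = restrictTo P (Set.Ioo Ea Eb)ᶜ v :=
  funext fun l => P.sub_proj measurableSet_Ioo (v l)

theorem specMeasure_real_Iic_add_Ici {Ea Eb : ℝ} (hE : Ea < Eb) :
    (specMeasure P v).real (Set.Iic Ea) + (specMeasure P v).real (Set.Ici Eb) =
      ∑ l, ‖noise P Ea Eb v l‖ ^ 2 := by
  rw [specMeasure_real_apply P v measurableSet_Iic, specMeasure_real_apply P v measurableSet_Ici,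
    ← Finset.sum_add_distrib, noise_eq_restrictTo]
  exact Finset.sum_congr rfl fun l _ => (P.norm_sq_compl_Ioo hE (v l)).symm

theorem synthesis_restrictTo (S : Set ℝ) (x : EuclideanSpace 𝕜 (Fin M)) :
    synthesis 𝕜 (restrictTo P S v) x = P.proj S (synthesis 𝕜 v x) := by
  simp [synthesis_apply, restrictTo]

variable {P v} {g : ℝ}

/- With `y = ∑ l, z l • v l`, Cauchy–Schwarz gives `‖P(S) y‖² ≤ ‖z‖² ∑ l, ‖P(S) v_l‖²`. -/
theorem IsLowerFrameBound.smul_measure_le (hv : IsLowerFrameBound 𝕜 v g) (hg : 0 ≤ g) {y : ℋ}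
    (hy : y ∈ Submodule.span 𝕜 (Set.range v)) :
    ENNReal.ofReal g • P.measure y ≤ ENNReal.ofReal (‖y‖ ^ 2) • specMeasure P v := by
  obtain ⟨x, rfl⟩ := mem_span_range_iff_exists_synthesis.1 hy
  obtain ⟨z, hz, hgz⟩ := hv x
  rw [← hz]
  refine Measure.le_iff.2 fun S hS => ?_
  rw [Measure.smul_apply, Measure.smul_apply, P.measure_apply _ hS, smul_eq_mul, smul_eq_mul,
    ← ofReal_measureReal (μ := specMeasure P v), specMeasure_real_apply P v hS,
    ← ENNReal.ofReal_mul hg, ← ENNReal.ofReal_mul (sq_nonneg _)]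
  apply ENNReal.ofReal_le_ofReal
  calc g * ‖P.proj S (synthesis 𝕜 v z)‖ ^ 2
      ≤ g * (‖z‖ ^ 2 * ∑ l, ‖P.proj S (v l)‖ ^ 2) := by
        rw [← synthesis_restrictTo]
        exact mul_le_mul_of_nonneg_left (norm_synthesis_sq_le _ z) hg
    _ = g * ‖z‖ ^ 2 * ∑ l, ‖P.proj S (v l)‖ ^ 2 := (mul_assoc _ _ _).symm
    _ ≤ ‖synthesis 𝕜 v z‖ ^ 2 * ∑ l, ‖P.proj S (v l)‖ ^ 2 := by gcongr

theorem IsLowerFrameBound.mul_setIntegral_le (hv : IsLowerFrameBound 𝕜 v g) (hg : 0 ≤ g) {y : ℋ}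
    (hy : y ∈ Submodule.span 𝕜 (Set.range v)) {S : Set ℝ} (hS : MeasurableSet S) {f : ℝ → ℝ}
    (hf : Integrable f (specMeasure P v)) (hf0 : ∀ E ∈ S, 0 ≤ f E) :
    g * ∫ E in S, f E ∂P.measure y ≤ ‖y‖ ^ 2 * ∫ E in S, f E ∂specMeasure P v := by
  have hle := Measure.restrict_mono (le_refl S) (hv.smul_measure_le (P := P) hg hy)
  rw [Measure.restrict_smul, Measure.restrict_smul] at hle
  have hf0' : ∀ᵐ E ∂(specMeasure P v).restrict S, 0 ≤ f E := ae_restrict_of_forall_mem hS hf0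
  have h := integral_mono_measure hle (Measure.ae_smul_measure hf0' _)
    (hf.restrict.smul_measure ENNReal.ofReal_ne_top)
  rwa [integral_smul_measure, integral_smul_measure, ENNReal.toReal_ofReal hg,
    ENNReal.toReal_ofReal (sq_nonneg _)] at h

end SpecMeasure

namespace IsSpectralResolution

variable {H : ℋ →ₗ.[𝕜] ℋ} {P : ProjValuedMeasure 𝕜 ℋ}

theorem integrable_id (hP : IsSpectralResolution H P) {x : ℋ} (hx : x ∈ H.domain) :
    Integrable (fun E => E) (P.measure x) := by
  have hsq : Integrable (fun E : ℝ => E ^ 2) (P.measure x) := by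
    refine ⟨(measurable_id.pow_const 2).aestronglyMeasurable, ?_⟩
    rw [hasFiniteIntegral_iff_ofReal (Filter.Eventually.of_forall sq_nonneg)]
    exact (hP.mem_domain_iff x).1 hx
  exact ((memLp_two_iff_integrable_sq measurable_id.aestronglyMeasurable).2 hsq).integrable
    one_le_two

theorem integrable_sub_const (hP : IsSpectralResolution H P) {M : ℕ} (v : Fin M → H.domain)
    (c : ℝ) : Integrable (fun E => E - c) (specMeasure P fun l => (v l : ℋ)) := by
  refine Integrable.sub ?_ (integrable_const c)
  unfold specMeasure
  rw [integrable_finsetSum_measure]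
  exact fun l _ => hP.integrable_id (v l).2

theorem integral_sub_const (hP : IsSpectralResolution H P) (x : H.domain) (c : ℝ) :
    ∫ E, (E - c) ∂P.measure (x : ℋ) = RCLike.re (inner 𝕜 (x : ℋ) (H x)) - c * ‖(x : ℋ)‖ ^ 2 := by
  rw [integral_sub (hP.integrable_id x.2) (integrable_const c), integral_const,
    P.measureReal_univ, smul_eq_mul, mul_comm c, hP.inner_apply x, RCLike.ofReal_re]

end IsSpectralResolution

end SpectralMeasure

section Ritz

theorem map_sum_smul {κ : Type*} (H : ℋ →ₗ.[𝕜] ℋ) (s : Finset κ) (a : κ → 𝕜)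
    (e : κ → H.domain) : H (∑ i ∈ s, a i • e i) = ∑ i ∈ s, a i • H (e i) := by
  simp only [← LinearPMap.toFun_eq_coe, map_sum, map_smul]

/-- `e` is an orthonormal basis of the subspace `W` consisting of vectors of the domain of `H` that
diagonalizes the compression of `H` to `W`. The diagonal entries `μ`, in descending order, are the
Ritz values of `H` on `W`: the proper eigenvalues of the GEP when `W` is the span of the guess
vectors. -/
structure IsRitzBasis (H : ℋ →ₗ.[𝕜] ℋ) (W : Submodule 𝕜 ℋ) {n : ℕ} (e : Fin n → H.domain)
    (μ : Fin n → ℝ) : Prop where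
  orthonormal : Orthonormal 𝕜 fun i => (e i : ℋ)
  span_eq : Submodule.span 𝕜 (Set.range fun i => (e i : ℋ)) = W
  inner_apply : ∀ i j, inner 𝕜 (e i : ℋ) (H (e j)) = if i = j then (μ j : 𝕜) else 0
  antitone : Antitone μ

namespace IsRitzBasis

variable {H : ℋ →ₗ.[𝕜] ℋ} {W : Submodule 𝕜 ℋ} {n : ℕ} {e : Fin n → H.domain} {μ : Fin n → ℝ}

theorem of_finrank_eq [FiniteDimensional 𝕜 W] (he : Orthonormal 𝕜 fun i => (e i : ℋ))
    (hW : ∀ i, (e i : ℋ) ∈ W) (hn : Module.finrank 𝕜 W = n)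
    (hH : ∀ i j, inner 𝕜 (e i : ℋ) (H (e j)) = if i = j then (μ j : 𝕜) else 0)
    (hμ : Antitone μ) : IsRitzBasis H W e μ where
  orthonormal := he
  span_eq := by
    refine Submodule.eq_of_le_of_finrank_eq (Submodule.span_le.2 (Set.range_subset_iff.2 hW)) ?_
    rw [finrank_span_eq_card he.linearIndependent, Fintype.card_fin, hn]
  inner_apply := hH
  antitone := hμ

theorem mem (he : IsRitzBasis H W e μ) (i : Fin n) : (e i : ℋ) ∈ W :=
  he.span_eq ▸ Submodule.subset_span ⟨i, rfl⟩

theorem le_domain (he : IsRitzBasis H W e μ) : W ≤ H.domain := by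
  rw [← he.span_eq, Submodule.span_le]
  rintro _ ⟨i, rfl⟩
  exact (e i).2

theorem finrank_eq (he : IsRitzBasis H W e μ) : Module.finrank 𝕜 W = n := by
  rw [← he.span_eq, finrank_span_eq_card he.orthonormal.linearIndependent, Fintype.card_fin]

theorem sum_inner_smul (he : IsRitzBasis H W e μ) {y : ℋ} (hy : y ∈ W) :
    ∑ i, inner 𝕜 (e i : ℋ) y • (e i : ℋ) = y := by
  rw [← he.span_eq, Submodule.mem_span_range_iff_exists_fun] at hy
  obtain ⟨a, rfl⟩ := hy
  simp only [he.orthonormal.inner_right_fintype]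

theorem norm_sq_eq (he : IsRitzBasis H W e μ) {y : ℋ} (hy : y ∈ W) :
    ‖y‖ ^ 2 = ∑ i, ‖inner 𝕜 (e i : ℋ) y‖ ^ 2 := by
  conv_lhs => rw [← he.sum_inner_smul hy]
  rw [norm_sum_sq_of_pairwise_orthogonal (𝕜 := 𝕜)]
  · simp only [norm_smul, he.orthonormal.norm_eq_one, mul_one]
  · intro i j hij
    simp only [inner_smul_left, inner_smul_right, he.orthonormal.inner_eq_zero hij, mul_zero]

theorem re_inner_apply (he : IsRitzBasis H W e μ) (y : H.domain) (hy : (y : ℋ) ∈ W) :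
    RCLike.re (inner 𝕜 (y : ℋ) (H y)) = ∑ i, ‖inner 𝕜 (e i : ℋ) (y : ℋ)‖ ^ 2 * μ i := by
  have hy_eq : y = ∑ j, inner 𝕜 (e j : ℋ) (y : ℋ) • e j :=
    Subtype.ext (by simpa using (he.sum_inner_smul hy).symm)
  have hentry (i : Fin n) : inner 𝕜 (e i : ℋ) (H y) = (μ i : 𝕜) * inner 𝕜 (e i : ℋ) (y : ℋ) := by
    conv_lhs => rw [hy_eq, map_sum_smul]
    simp [inner_sum, inner_smul_right, he.inner_apply, mul_comm]
  conv_lhs => rw [← he.sum_inner_smul hy]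
  rw [sum_inner, map_sum]
  refine Finset.sum_congr rfl fun i _ => ?_
  rw [inner_smul_left, hentry, mul_left_comm, RCLike.conj_mul, ← RCLike.ofReal_pow,
    ← RCLike.ofReal_mul, RCLike.ofReal_re, mul_comm]

variable [CompleteSpace ℋ] {P : ProjValuedMeasure 𝕜 ℋ}

theorem integral_sub_const (he : IsRitzBasis H W e μ) (hP : IsSpectralResolution H P) {y : ℋ}
    (hy : y ∈ W) (c : ℝ) :
    ∫ E, (E - c) ∂P.measure y = ∑ i, ‖inner 𝕜 (e i : ℋ) y‖ ^ 2 * (μ i - c) := by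
  rw [hP.integral_sub_const ⟨y, he.le_domain hy⟩ c, he.re_inner_apply _ hy, he.norm_sq_eq hy,
    Finset.mul_sum, ← Finset.sum_sub_distrib]
  exact Finset.sum_congr rfl fun i _ => by ring

theorem setIntegral_sub_const (he : IsRitzBasis H W e μ) (hP : IsSpectralResolution H P)
    {S : Set ℝ} (hS : MeasurableSet S) (hW : ∀ z ∈ W, P.proj S z = z) {y : ℋ}
    (hy : P.proj S y ∈ W) (c : ℝ) :
    ∫ E in S, (E - c) ∂P.measure y = ∑ i, ‖inner 𝕜 (e i : ℋ) y‖ ^ 2 * (μ i - c) := by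
  rw [← P.measure_proj y hS, he.integral_sub_const hP hy]
  simp only [← P.inner_proj_left hS, hW _ (he.mem _)]

theorem mem_Icc (he : IsRitzBasis H W e μ) (hP : IsSpectralResolution H P) {Ea Eb : ℝ}
    (hW : ∀ z ∈ W, P.proj (Set.Ioo Ea Eb) z = z) (i : Fin n) : μ i ∈ Set.Icc Ea Eb := by
  have hμ (c : ℝ) : ∫ E in Set.Ioo Ea Eb, (E - c) ∂P.measure (e i : ℋ) = μ i - c := by
    rw [he.setIntegral_sub_const hP measurableSet_Ioo hW (by rw [hW _ (he.mem i)]; exact he.mem i)]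
    simp [orthonormal_iff_ite.1 he.orthonormal, apply_ite]
  constructor
  · rw [← sub_nonneg, ← hμ]
    exact setIntegral_nonneg measurableSet_Ioo fun E hE => sub_nonneg.2 hE.1.le
  · rw [← sub_nonpos, ← hμ]
    exact setIntegral_nonpos measurableSet_Ioo fun E hE => sub_nonpos.2 hE.2.le

end IsRitzBasis

theorem star_dotProduct_projMatrix {H : ℋ →ₗ.[𝕜] ℋ} {M : ℕ} (v : Fin M → H.domain)
    (x y : Fin M → 𝕜) :
    star x ⬝ᵥ (projMatrix H v *ᵥ y) =
      inner 𝕜 ((∑ l, x l • v l : H.domain) : ℋ) (H (∑ l, y l • v l)) := by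
  rw [map_sum_smul, Submodule.coe_sum, sum_inner]
  refine Finset.sum_congr rfl fun i _ => ?_
  rw [Submodule.coe_smul, inner_smul_left, inner_sum]
  simp [mulVec, dotProduct, inner_smul_right, projMatrix, mul_comm]

theorem exists_isRitzBasis_genEig [CompleteSpace ℋ] {H : ℋ →ₗ.[𝕜] ℋ} (hH : IsSelfAdjoint H)
    {M : ℕ} (v : Fin M → H.domain) :
    ∃ e : Fin (gramRank 𝕜 fun l => (v l : ℋ)) → H.domain,
      IsRitzBasis H (Submodule.span 𝕜 (Set.range fun l => (v l : ℋ))) e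
        fun i => genEig hH v (i + 1) := by
  obtain ⟨hanti, x, hx, hort⟩ := (exists_isProperSpectrum hH v).choose_spec
  have hgenEig (i : Fin (gramRank 𝕜 fun l => (v l : ℋ))) :
      (exists_isProperSpectrum hH v).choose i = genEig hH v (i + 1) := by
    rw [genEig, dif_pos ⟨Nat.succ_pos _, i.2⟩]
    rfl
  have : FiniteDimensional 𝕜 (Submodule.span 𝕜 (Set.range fun l => (v l : ℋ))) :=
    FiniteDimensional.span_of_finite 𝕜 (Set.finite_range _)
  refine ⟨fun i => ∑ l, x i l • v l, .of_finrank_eq ?_ (fun i => ?_) ?_ (fun i j => ?_) ?_⟩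
  · refine orthonormal_iff_ite.2 fun i j => ?_
    simp only [← hort i j, gramMatrix, star_dotProduct_gram, Submodule.coe_sum, Submodule.coe_smul]
  · simp only [Submodule.coe_sum, Submodule.coe_smul]
    exact Submodule.sum_smul_mem _ _ fun l _ => Submodule.subset_span ⟨l, rfl⟩
  · rw [gramRank_eq]
  · rw [← star_dotProduct_projMatrix, hx j, dotProduct_smul, hort i j, ← hgenEig]
    split_ifs <;> simp
  · exact funext hgenEig ▸ hanti

end Ritz

section Comparison

theorem card_filter_lt_val (n m : ℕ) :
    (Finset.univ.filter fun i : Fin n => m < i).card = n - (m + 1) := by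
  have h := Finset.card_filter_add_card_filter_not (s := Finset.univ) fun i : Fin n =>
    (i : ℕ) < m + 1
  simp only [Fin.card_filter_val_lt, Finset.card_univ, Fintype.card_fin, not_lt,
    Nat.succ_le_iff] at h
  omega

theorem integral_eq_Iic_add_Ioo_add_Ici {ρ : Measure ℝ} {a b : ℝ} (hab : a < b) {f : ℝ → ℝ}
    (hf : Integrable f ρ) :
    ∫ E, f E ∂ρ =
      ∫ E in Set.Iic a, f E ∂ρ + ∫ E in Set.Ioo a b, f E ∂ρ + ∫ E in Set.Ici b, f E ∂ρ := by
  have hIicIoo : Disjoint (Set.Iic a) (Set.Ioo a b) :=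
    (Set.Iic_disjoint_Ioi le_rfl).mono_right Set.Ioo_subset_Ioi_self
  have hIioIci : Disjoint (Set.Iio b) (Set.Ici b) := Set.Iio_disjoint_Ici le_rfl
  rw [← setIntegral_union hIicIoo measurableSet_Ioo hf.integrableOn hf.integrableOn,
    Set.Iic_union_Ioo_eq_Iio hab,
    ← setIntegral_union hIioIci measurableSet_Ici hf.integrableOn hf.integrableOn,
    Set.Iio_union_Ici, setIntegral_univ]

namespace IsRitzBasis

variable [CompleteSpace ℋ] {H : ℋ →ₗ.[𝕜] ℋ} {P : ProjValuedMeasure 𝕜 ℋ} {W Z : Submodule 𝕜 ℋ}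
  {n r : ℕ} {e : Fin n → H.domain} {μ : Fin n → ℝ} {w : Fin r → H.domain} {ν : Fin r → ℝ}
  {Ea Eb c : ℝ}

theorem sum_eq_Iic_add_sum_add_Ici (he : IsRitzBasis H W e μ) (hw : IsRitzBasis H Z w ν)
    (hP : IsSpectralResolution H P) (hE : Ea < Eb)
    (hZ : ∀ z ∈ Z, P.proj (Set.Ioo Ea Eb) z = z) {y : ℋ} (hyW : y ∈ W)
    (hyZ : P.proj (Set.Ioo Ea Eb) y ∈ Z) (c : ℝ) :
    ∑ i, ‖inner 𝕜 (e i : ℋ) y‖ ^ 2 * (μ i - c) =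
      ∫ E in Set.Iic Ea, (E - c) ∂P.measure y + ∑ j, ‖inner 𝕜 (w j : ℋ) y‖ ^ 2 * (ν j - c) +
        ∫ E in Set.Ici Eb, (E - c) ∂P.measure y := by
  rw [← he.integral_sub_const hP hyW, ← hw.setIntegral_sub_const hP measurableSet_Ioo hZ hyZ]
  exact integral_eq_Iic_add_Ioo_add_Ici hE
    ((hP.integrable_id (he.le_domain hyW)).sub (integrable_const c))

/- The Courant–Fischer argument: `y` lies in the span of the first `i` Ritz vectors of `W` and is
orthogonal to the first `i - 1` Ritz vectors of `Z`. -/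
theorem exists_mul_norm_sq_le_setIntegral_Ici (he : IsRitzBasis H W e μ)
    (hw : IsRitzBasis H Z w ν) (hP : IsSpectralResolution H P) (hE : Ea < Eb)
    (hZ : ∀ z ∈ Z, P.proj (Set.Ioo Ea Eb) z = z) (hWZ : ∀ y ∈ W, P.proj (Set.Ioo Ea Eb) y ∈ Z)
    (i : Fin n) (hc : c ∈ Set.Icc Ea Eb) (hν : ∀ j : Fin r, (i : ℕ) ≤ j → ν j ≤ c) :
    ∃ y ∈ W, y ≠ 0 ∧ (μ i - c) * ‖y‖ ^ 2 ≤ ∫ E in Set.Ici Eb, (E - c) ∂P.measure y := by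
  obtain ⟨y, hyW, hy0, hy⟩ := exists_mem_ne_zero_forall_inner_eq_zero W
    (Sum.elim (fun k : {k : Fin n // i < k} => (e k : ℋ))
      (fun j : {j : Fin r // (j : ℕ) < i} => (w j : ℋ))) (by
        rw [he.finrank_eq, Fintype.card_sum, Fintype.card_subtype, Fintype.card_subtype,
          Finset.filter_lt_eq_Ioi, Fin.card_Ioi, Fin.card_filter_val_lt]
        omega)
  have hye (k : Fin n) (hk : i < k) : inner 𝕜 (e k : ℋ) y = 0 := hy (.inl ⟨k, hk⟩)
  have hyw (j : Fin r) (hj : (j : ℕ) < i) : inner 𝕜 (w j : ℋ) y = 0 := hy (.inr ⟨j, hj⟩)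
  refine ⟨y, hyW, hy0, ?_⟩
  have hbalance := he.sum_eq_Iic_add_sum_add_Ici hw hP hE hZ hyW (hWZ y hyW) c
  have hsum_e : (μ i - c) * ‖y‖ ^ 2 ≤ ∑ k, ‖inner 𝕜 (e k : ℋ) y‖ ^ 2 * (μ k - c) := by
    rw [he.norm_sq_eq hyW, Finset.mul_sum]
    refine Finset.sum_le_sum fun k _ => ?_
    rcases lt_or_ge i k with hk | hk
    · simp [hye k hk]
    · rw [mul_comm]
      exact mul_le_mul_of_nonneg_left (sub_le_sub_right (he.antitone hk) c) (sq_nonneg _)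
  have hIic : ∫ E in Set.Iic Ea, (E - c) ∂P.measure y ≤ 0 :=
    setIntegral_nonpos measurableSet_Iic fun E hE => sub_nonpos.2 (hE.trans hc.1)
  have hsum_w : ∑ j, ‖inner 𝕜 (w j : ℋ) y‖ ^ 2 * (ν j - c) ≤ 0 := by
    refine Finset.sum_nonpos fun j _ => ?_
    rcases lt_or_ge (j : ℕ) i with hj | hj
    · simp [hyw j hj]
    · exact mul_nonpos_of_nonneg_of_nonpos (sq_nonneg _) (sub_nonpos.2 (hν j hj))
  linarith

theorem exists_setIntegral_Iic_le_mul_norm_sq (he : IsRitzBasis H W e μ)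
    (hw : IsRitzBasis H Z w ν) (hP : IsSpectralResolution H P) (hE : Ea < Eb)
    (hZ : ∀ z ∈ Z, P.proj (Set.Ioo Ea Eb) z = z) (hWZ : ∀ y ∈ W, P.proj (Set.Ioo Ea Eb) y ∈ Z)
    (hrn : r ≤ n) (i : Fin n) (hc : c ∈ Set.Icc Ea Eb)
    (hν : ∀ j : Fin r, (j : ℕ) ≤ i → c ≤ ν j) :
    ∃ y ∈ W, y ≠ 0 ∧ ∫ E in Set.Iic Ea, (E - c) ∂P.measure y ≤ (μ i - c) * ‖y‖ ^ 2 := by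
  obtain ⟨y, hyW, hy0, hy⟩ := exists_mem_ne_zero_forall_inner_eq_zero W
    (Sum.elim (fun k : {k : Fin n // k < i} => (e k : ℋ))
      (fun j : {j : Fin r // (i : ℕ) < j} => (w j : ℋ))) (by
        rw [he.finrank_eq, Fintype.card_sum, Fintype.card_subtype, Fintype.card_subtype,
          Finset.filter_gt_eq_Iio, Fin.card_Iio, card_filter_lt_val]
        omega)
  have hye (k : Fin n) (hk : k < i) : inner 𝕜 (e k : ℋ) y = 0 := hy (.inl ⟨k, hk⟩)
  have hyw (j : Fin r) (hj : (i : ℕ) < j) : inner 𝕜 (w j : ℋ) y = 0 := hy (.inr ⟨j, hj⟩)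
  refine ⟨y, hyW, hy0, ?_⟩
  have hbalance := he.sum_eq_Iic_add_sum_add_Ici hw hP hE hZ hyW (hWZ y hyW) c
  have hsum_e : ∑ k, ‖inner 𝕜 (e k : ℋ) y‖ ^ 2 * (μ k - c) ≤ (μ i - c) * ‖y‖ ^ 2 := by
    rw [he.norm_sq_eq hyW, Finset.mul_sum]
    refine Finset.sum_le_sum fun k _ => ?_
    rcases lt_or_ge k i with hk | hk
    · simp [hye k hk]
    · rw [mul_comm]
      exact mul_le_mul_of_nonneg_right (sub_le_sub_right (he.antitone hk) c) (sq_nonneg _)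
  have hIci : 0 ≤ ∫ E in Set.Ici Eb, (E - c) ∂P.measure y :=
    setIntegral_nonneg measurableSet_Ici fun E hE => sub_nonneg.2 (hc.2.trans hE)
  have hsum_w : 0 ≤ ∑ j, ‖inner 𝕜 (w j : ℋ) y‖ ^ 2 * (ν j - c) := by
    refine Finset.sum_nonneg fun j _ => ?_
    rcases lt_or_ge (i : ℕ) j with hj | hj
    · simp [hyw j hj]
    · exact mul_nonneg (sq_nonneg _) (sub_nonneg.2 (hν j hj))
  linarith

section GuessVectors

variable {M : ℕ} {v : Fin M → H.domain} {g : ℝ}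

theorem mul_sub_le_setIntegral_Ici
    (he : IsRitzBasis H (Submodule.span 𝕜 (Set.range fun l => (v l : ℋ))) e μ)
    (hw : IsRitzBasis H Z w ν) (hP : IsSpectralResolution H P) (hE : Ea < Eb)
    (hZ : ∀ z ∈ Z, P.proj (Set.Ioo Ea Eb) z = z)
    (hvZ : ∀ y ∈ Submodule.span 𝕜 (Set.range fun l => (v l : ℋ)), P.proj (Set.Ioo Ea Eb) y ∈ Z)
    (hv : IsLowerFrameBound 𝕜 (fun l => (v l : ℋ)) g) (hg : 0 ≤ g)
    (i : Fin n) (hc : c ∈ Set.Icc Ea Eb) (hν : ∀ j : Fin r, (i : ℕ) ≤ j → ν j ≤ c) :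
    g * (μ i - c) ≤ ∫ E in Set.Ici Eb, (E - c) ∂specMeasure P fun l => (v l : ℋ) := by
  obtain ⟨y, hy, hy0, hle⟩ := he.exists_mul_norm_sq_le_setIntegral_Ici hw hP hE hZ hvZ i hc hν
  have hspec := hv.mul_setIntegral_le hg hy measurableSet_Ici (hP.integrable_sub_const v c)
    fun E hE => sub_nonneg.2 (hc.2.trans hE)
  have hpos : 0 < ‖y‖ ^ 2 := by positivity
  refine le_of_mul_le_mul_left ?_ hpos
  calc ‖y‖ ^ 2 * (g * (μ i - c)) = g * ((μ i - c) * ‖y‖ ^ 2) := by ring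
    _ ≤ g * ∫ E in Set.Ici Eb, (E - c) ∂P.measure y := mul_le_mul_of_nonneg_left hle hg
    _ ≤ _ := hspec

theorem setIntegral_Iic_le_mul_sub
    (he : IsRitzBasis H (Submodule.span 𝕜 (Set.range fun l => (v l : ℋ))) e μ)
    (hw : IsRitzBasis H Z w ν) (hP : IsSpectralResolution H P) (hE : Ea < Eb)
    (hZ : ∀ z ∈ Z, P.proj (Set.Ioo Ea Eb) z = z)
    (hvZ : ∀ y ∈ Submodule.span 𝕜 (Set.range fun l => (v l : ℋ)), P.proj (Set.Ioo Ea Eb) y ∈ Z)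
    (hv : IsLowerFrameBound 𝕜 (fun l => (v l : ℋ)) g) (hg : 0 ≤ g) (hrn : r ≤ n)
    (i : Fin n) (hc : c ∈ Set.Icc Ea Eb) (hν : ∀ j : Fin r, (j : ℕ) ≤ i → c ≤ ν j) :
    ∫ E in Set.Iic Ea, (E - c) ∂specMeasure P (fun l => (v l : ℋ)) ≤ g * (μ i - c) := by
  obtain ⟨y, hy, hy0, hle⟩ := he.exists_setIntegral_Iic_le_mul_norm_sq hw hP hE hZ hvZ hrn i hc hν
  have hspec := hv.mul_setIntegral_le hg hy measurableSet_Iic (hP.integrable_sub_const v c).neg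
    fun E hE => neg_nonneg.2 (sub_nonpos.2 (hE.trans hc.1))
  simp only [Pi.neg_apply, integral_neg, mul_neg, neg_le_neg_iff] at hspec
  have hpos : 0 < ‖y‖ ^ 2 := by positivity
  refine le_of_mul_le_mul_left ?_ hpos
  calc ‖y‖ ^ 2 * ∫ E in Set.Iic Ea, (E - c) ∂specMeasure P (fun l => (v l : ℋ))
      ≤ g * ∫ E in Set.Iic Ea, (E - c) ∂P.measure y := hspec
    _ ≤ g * ((μ i - c) * ‖y‖ ^ 2) := mul_le_mul_of_nonneg_left hle hg
    _ = ‖y‖ ^ 2 * (g * (μ i - c)) := by ring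

theorem sub_le_setIntegral_Ici_div
    (he : IsRitzBasis H (Submodule.span 𝕜 (Set.range fun l => (v l : ℋ))) e μ)
    (hw : IsRitzBasis H Z w ν) (hP : IsSpectralResolution H P) (hE : Ea < Eb)
    (hZ : ∀ z ∈ Z, P.proj (Set.Ioo Ea Eb) z = z)
    (hvZ : ∀ y ∈ Submodule.span 𝕜 (Set.range fun l => (v l : ℋ)), P.proj (Set.Ioo Ea Eb) y ∈ Z)
    (hv : IsLowerFrameBound 𝕜 (fun l => (v l : ℋ)) g) (hg : 0 < g)
    (i : Fin n) (j : Fin r) (hij : (i : ℕ) = j) :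
    μ i - ν j ≤ (∫ E in Set.Ici Eb, (E - ν j) ∂specMeasure P fun l => (v l : ℋ)) / g := by
  rw [le_div_iff₀' hg]
  exact he.mul_sub_le_setIntegral_Ici hw hP hE hZ hvZ hv hg.le i (hw.mem_Icc hP hZ j)
    fun k hk => hw.antitone (Fin.le_def.2 (hij ▸ hk))

theorem setIntegral_Iic_div_le_sub
    (he : IsRitzBasis H (Submodule.span 𝕜 (Set.range fun l => (v l : ℋ))) e μ)
    (hw : IsRitzBasis H Z w ν) (hP : IsSpectralResolution H P) (hE : Ea < Eb)
    (hZ : ∀ z ∈ Z, P.proj (Set.Ioo Ea Eb) z = z)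
    (hvZ : ∀ y ∈ Submodule.span 𝕜 (Set.range fun l => (v l : ℋ)), P.proj (Set.Ioo Ea Eb) y ∈ Z)
    (hv : IsLowerFrameBound 𝕜 (fun l => (v l : ℋ)) g) (hg : 0 < g) (hrn : r ≤ n)
    (i : Fin n) (j : Fin r) (hij : (i : ℕ) = j) :
    (∫ E in Set.Iic Ea, (E - ν j) ∂specMeasure P fun l => (v l : ℋ)) / g ≤ μ i - ν j := by
  rw [div_le_iff₀' hg]
  exact he.setIntegral_Iic_le_mul_sub hw hP hE hZ hvZ hv hg.le hrn i (hw.mem_Icc hP hZ j)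
    fun k hk => hw.antitone (Fin.le_def.2 (hij ▸ hk))

end GuessVectors

end IsRitzBasis

end Comparison

section GramSpectrum

variable {M : ℕ} (v : Fin M → ℋ)

theorem gramEig_add_one (k : Fin M) :
    gramEig 𝕜 v (k + 1) =
      (isHermitian_gram 𝕜 v).eigenvalues₀ (Fin.cast (Fintype.card_fin M).symm k) := by
  rw [gramEig, dif_pos ⟨Nat.succ_pos _, k.2⟩]
  rfl

theorem exists_equiv_gramEig_eq_eigenvalues :
    ∃ σ : Fin M ≃ Fin M, ∀ k : Fin M,
      gramEig 𝕜 v (k + 1) = (isHermitian_gram 𝕜 v).eigenvalues (σ k) := by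
  refine ⟨(finCongr (Fintype.card_fin M).symm).trans
    (Fintype.equivOfCardEq (Fintype.card_fin _)), fun k => ?_⟩
  simp [gramEig_add_one, IsHermitian.eigenvalues]

theorem gramEig_antitone : Antitone fun k : Fin M => gramEig 𝕜 v (k + 1) := by
  intro j k hjk
  simp only [gramEig_add_one]
  exact (isHermitian_gram 𝕜 v).eigenvalues₀_antitone hjk

theorem gramEig_le_gramEig_one (k : Fin M) : gramEig 𝕜 v (k + 1) ≤ gramEig 𝕜 v 1 := by
  have : NeZero M := ⟨k.pos.ne'⟩
  simpa using gramEig_antitone (𝕜 := 𝕜) v (Fin.zero_le k)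

theorem gramEig_nonneg (k : ℕ) : 0 ≤ gramEig 𝕜 v k := by
  by_cases hk : 1 ≤ k ∧ k ≤ M
  · obtain ⟨σ, hσ⟩ := exists_equiv_gramEig_eq_eigenvalues (𝕜 := 𝕜) v
    rw [← Nat.sub_add_cancel hk.1, hσ ⟨k - 1, Nat.sub_one_lt_of_le hk.1 hk.2⟩]
    exact (posSemidef_gram 𝕜 v).eigenvalues_nonneg _
  · rw [gramEig, dif_neg hk]

theorem trace_gram : (gram 𝕜 v).trace = ((∑ l, ‖v l‖ ^ 2 : ℝ) : 𝕜) := by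
  simp [Matrix.trace, gram_apply, inner_self_eq_norm_sq_to_K]

theorem sum_gramEig : ∑ k : Fin M, gramEig 𝕜 v (k + 1) = ∑ l, ‖v l‖ ^ 2 := by
  obtain ⟨σ, hσ⟩ := exists_equiv_gramEig_eq_eigenvalues (𝕜 := 𝕜) v
  have htrace := (isHermitian_gram 𝕜 v).trace_eq_sum_eigenvalues
  simp only [hσ, Equiv.sum_comp σ (isHermitian_gram 𝕜 v).eigenvalues]
  apply RCLike.ofReal_injective (K := 𝕜)
  rw [RCLike.ofReal_sum, ← htrace, trace_gram]

theorem gramEig_pos_iff (k : Fin M) : 0 < gramEig 𝕜 v (k + 1) ↔ (k : ℕ) < gramRank 𝕜 v := by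
  obtain ⟨σ, hσ⟩ := exists_equiv_gramEig_eq_eigenvalues (𝕜 := 𝕜) v
  have hrank : gramRank 𝕜 v =
      (Finset.univ.filter fun j : Fin M => 0 < gramEig 𝕜 v (j + 1)).card := by
    rw [gramRank, (isHermitian_gram 𝕜 v).rank_eq_card_non_zero_eigs, Fintype.card_subtype]
    refine (Finset.card_equiv σ fun j => ?_).symm
    simp [← hσ, (gramEig_nonneg v _).lt_iff_ne']
  rw [hrank]
  exact (Fin.lt_card_filter_univ_iff_apply_of_imp (fun j : Fin M => 0 < gramEig 𝕜 v (j + 1))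
    fun i j hji hi => lt_of_lt_of_le hi (gramEig_antitone v hji)).symm

theorem lt_detectedDim_iff (ε : ℝ) (k : Fin M) :
    (k : ℕ) < detectedDim 𝕜 v ε ↔ ε ≤ gramEig 𝕜 v (k + 1) :=
  Fin.lt_card_filter_univ_iff_apply_of_imp (fun j : Fin M => ε ≤ gramEig 𝕜 v (j + 1))
    fun _ _ hji hi => le_trans hi (gramEig_antitone v hji)

theorem gramRank_le : gramRank 𝕜 v ≤ M :=
  (gram 𝕜 v).rank_le_card_width.trans_eq (Fintype.card_fin M)

theorem exists_add_one_eq_gramRank (h : 0 < gramRank 𝕜 v) :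
    ∃ j : Fin M, (j : ℕ) + 1 = gramRank 𝕜 v :=
  ⟨⟨gramRank 𝕜 v - 1, Nat.sub_one_lt_of_le h (gramRank_le v)⟩, Nat.sub_add_cancel h⟩

theorem lowestGramEig_le {k : Fin M} (hk : 0 < gramEig 𝕜 v (k + 1)) :
    lowestGramEig 𝕜 v ≤ gramEig 𝕜 v (k + 1) := by
  have hk := (gramEig_pos_iff v k).1 hk
  obtain ⟨j, hj⟩ := exists_add_one_eq_gramRank v (Nat.zero_lt_of_lt hk)
  rw [lowestGramEig, ← hj]
  exact gramEig_antitone v (Fin.le_def.2 (by omega))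

theorem sum_norm_sq_le : ∑ l, ‖v l‖ ^ 2 ≤ gramRank 𝕜 v * gramEig 𝕜 v 1 := by
  rw [← sum_gramEig (𝕜 := 𝕜)]
  calc ∑ k : Fin M, gramEig 𝕜 v (k + 1)
      = ∑ k ∈ Finset.univ.filter fun k : Fin M => (k : ℕ) < gramRank 𝕜 v,
          gramEig 𝕜 v (k + 1) := by
        refine (Finset.sum_filter_of_ne fun k _ hk => ?_).symm
        rwa [← gramEig_pos_iff, (gramEig_nonneg v _).lt_iff_ne']
    _ ≤ (Finset.univ.filter fun k : Fin M => (k : ℕ) < gramRank 𝕜 v).card • gramEig 𝕜 v 1 :=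
        Finset.sum_le_card_nsmul _ _ _ fun k _ => gramEig_le_gramEig_one v k
    _ = gramRank 𝕜 v * gramEig 𝕜 v 1 := by
        rw [Fin.card_filter_val_lt, min_eq_right (gramRank_le v), nsmul_eq_mul]

variable {v} in
theorem gramRank_pos_iff [CompleteSpace ℋ] : 0 < gramRank 𝕜 v ↔ v ≠ 0 := by
  have : FiniteDimensional 𝕜 (Submodule.span 𝕜 (Set.range v)) :=
    FiniteDimensional.span_of_finite 𝕜 (Set.finite_range v)
  rw [Nat.pos_iff_ne_zero, gramRank_eq, Ne, Submodule.finrank_eq_zero, Submodule.span_eq_bot,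
    Set.forall_mem_range, Ne, funext_iff]
  rfl

theorem lowestGramEig_nonneg : 0 ≤ lowestGramEig 𝕜 v :=
  gramEig_nonneg v _

variable {v} in
theorem lowestGramEig_pos_iff [CompleteSpace ℋ] : 0 < lowestGramEig 𝕜 v ↔ v ≠ 0 := by
  rw [← gramRank_pos_iff (𝕜 := 𝕜)]
  constructor
  · intro h
    by_contra hrank
    simp [lowestGramEig, Nat.eq_zero_of_not_pos hrank, gramEig] at h
  · intro h
    obtain ⟨j, hj⟩ := exists_add_one_eq_gramRank v h
    rw [lowestGramEig, ← hj, gramEig_pos_iff]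
    omega

/-- `b` is an orthonormal eigenbasis of the Gram matrix, with eigenvalues in descending order:
a system of right singular vectors of the synthesis operator. -/
def IsGramBasis (b : OrthonormalBasis (Fin M) 𝕜 (EuclideanSpace 𝕜 (Fin M))) : Prop :=
  ∀ k, gram 𝕜 v *ᵥ (b k).ofLp = ((gramEig 𝕜 v (k + 1) : ℝ) : 𝕜) • (b k).ofLp

theorem exists_isGramBasis :
    ∃ b : OrthonormalBasis (Fin M) 𝕜 (EuclideanSpace 𝕜 (Fin M)), IsGramBasis v b := by
  obtain ⟨σ, hσ⟩ := exists_equiv_gramEig_eq_eigenvalues (𝕜 := 𝕜) v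
  refine ⟨(isHermitian_gram 𝕜 v).eigenvectorBasis.reindex σ.symm, fun k => ?_⟩
  rw [hσ k, OrthonormalBasis.reindex_apply, Equiv.symm_symm, IsHermitian.mulVec_eigenvectorBasis,
    RCLike.real_smul_eq_coe_smul (K := 𝕜)]

namespace IsGramBasis

variable {v} {b : OrthonormalBasis (Fin M) 𝕜 (EuclideanSpace 𝕜 (Fin M))}

theorem inner_synthesis (hb : IsGramBasis v b) (k : Fin M) (x : EuclideanSpace 𝕜 (Fin M)) :
    inner 𝕜 (synthesis 𝕜 v (b k)) (synthesis 𝕜 v x) =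
      (gramEig 𝕜 v (k + 1) : 𝕜) * inner 𝕜 (b k) x := by
  rw [← inner_conj_symm, synthesis_apply, synthesis_apply, ← star_dotProduct_gram_mulVec, hb k,
    dotProduct_smul, smul_eq_mul, map_mul, RCLike.conj_ofReal, ← inner_conj_symm (b k) x,
    EuclideanSpace.inner_eq_star_dotProduct x, dotProduct_comm]

theorem norm_synthesis_sq (hb : IsGramBasis v b) (x : EuclideanSpace 𝕜 (Fin M)) :
    ‖synthesis 𝕜 v x‖ ^ 2 = ∑ k : Fin M, gramEig 𝕜 v (k + 1) * ‖inner 𝕜 (b k) x‖ ^ 2 := by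
  rw [← inner_self_eq_norm_sq (𝕜 := 𝕜)]
  nth_rw 1 [← b.sum_repr' x]
  simp only [map_sum, map_smul, sum_inner, inner_smul_left, hb.inner_synthesis]
  refine Finset.sum_congr rfl fun k _ => ?_
  rw [mul_left_comm, RCLike.conj_mul, ← RCLike.ofReal_pow, ← RCLike.ofReal_mul, RCLike.ofReal_re]

theorem norm_synthesis_basis_sq (hb : IsGramBasis v b) (k : Fin M) :
    ‖synthesis 𝕜 v (b k)‖ ^ 2 = gramEig 𝕜 v (k + 1) := by
  rw [hb.norm_synthesis_sq]
  simp [orthonormal_iff_ite.1 b.orthonormal, apply_ite]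

theorem synthesis_basis_eq_zero_iff (hb : IsGramBasis v b) (k : Fin M) :
    synthesis 𝕜 v (b k) = 0 ↔ gramEig 𝕜 v (k + 1) = 0 := by
  rw [← hb.norm_synthesis_basis_sq, sq_eq_zero_iff, norm_eq_zero]

end IsGramBasis

theorem norm_synthesis_sq_le_gramEig_one_mul (x : EuclideanSpace 𝕜 (Fin M)) :
    ‖synthesis 𝕜 v x‖ ^ 2 ≤ gramEig 𝕜 v 1 * ‖x‖ ^ 2 := by
  obtain ⟨b, hb⟩ := exists_isGramBasis (𝕜 := 𝕜) v
  rw [hb.norm_synthesis_sq, ← b.sum_sq_norm_inner_right, Finset.mul_sum]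
  exact Finset.sum_le_sum fun k _ =>
    mul_le_mul_of_nonneg_right (gramEig_le_gramEig_one v k) (sq_nonneg _)

variable {v} in
theorem gramEig_one_le {C : ℝ} (hC : 0 ≤ C) (h : ∀ x, ‖synthesis 𝕜 v x‖ ^ 2 ≤ C * ‖x‖ ^ 2) :
    gramEig 𝕜 v 1 ≤ C := by
  rcases Nat.eq_zero_or_pos M with hM | hM
  · rwa [gramEig, dif_neg (by omega)]
  · obtain ⟨b, hb⟩ := exists_isGramBasis (𝕜 := 𝕜) v
    simpa [hb.norm_synthesis_basis_sq] using h (b ⟨0, hM⟩)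

theorem gramEig_one_le_sum_norm_sq : gramEig 𝕜 v 1 ≤ ∑ l, ‖v l‖ ^ 2 :=
  gramEig_one_le (by positivity) fun x => (norm_synthesis_sq_le v x).trans_eq (mul_comm _ _)

theorem isLowerFrameBound_lowestGramEig : IsLowerFrameBound 𝕜 v (lowestGramEig 𝕜 v) := by
  intro x
  obtain ⟨b, hb⟩ := exists_isGramBasis (𝕜 := 𝕜) v
  let z : EuclideanSpace 𝕜 (Fin M) :=
    ∑ k : Fin M, (if gramEig 𝕜 v (k + 1) = 0 then 0 else inner 𝕜 (b k) x) • b k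
  have hz (k : Fin M) :
      inner 𝕜 (b k) z = if gramEig 𝕜 v (k + 1) = 0 then 0 else inner 𝕜 (b k) x :=
    b.orthonormal.inner_right_fintype _ k
  refine ⟨z, ?_, ?_⟩
  · conv_rhs => rw [← b.sum_repr' x]
    simp only [z, map_sum, map_smul]
    refine Finset.sum_congr rfl fun k _ => ?_
    split_ifs with hk
    · rw [(hb.synthesis_basis_eq_zero_iff k).2 hk, smul_zero, smul_zero]
    · rfl
  · rw [hb.norm_synthesis_sq, ← b.sum_sq_norm_inner_right, Finset.mul_sum]
    refine Finset.sum_le_sum fun k _ => ?_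
    rcases (gramEig_nonneg (𝕜 := 𝕜) v (k + 1)).eq_or_lt' with hk | hk
    · simp [hz, hk]
    · exact mul_le_mul_of_nonneg_right (lowestGramEig_le v hk) (sq_nonneg _)

variable {v} in
theorem IsLowerFrameBound.le_lowestGramEig [CompleteSpace ℋ] {g : ℝ}
    (hv : IsLowerFrameBound 𝕜 v g) (hv0 : v ≠ 0) : g ≤ lowestGramEig 𝕜 v := by
  obtain ⟨b, hb⟩ := exists_isGramBasis (𝕜 := 𝕜) v
  obtain ⟨j, hj⟩ := exists_add_one_eq_gramRank v (gramRank_pos_iff (𝕜 := 𝕜).2 hv0)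
  have hpos : 0 < gramEig 𝕜 v (j + 1) := (gramEig_pos_iff v j).2 (by omega)
  obtain ⟨z, hz, hgz⟩ := hv (b j)
  have hinner : inner 𝕜 (b j) z = 1 := by
    have h := hb.inner_synthesis j z
    rw [hz, hb.inner_synthesis, inner_self_eq_norm_sq_to_K, b.orthonormal.norm_eq_one] at h
    simpa [hpos.ne'] using h.symm
  have hnorm : 1 ≤ ‖z‖ := by
    simpa [hinner, b.orthonormal.norm_eq_one] using norm_inner_le_norm (𝕜 := 𝕜) (b j) z
  rw [hz, hb.norm_synthesis_basis_sq] at hgz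
  rw [lowestGramEig, ← hj]
  nlinarith [one_le_pow₀ hnorm (n := 2)]

theorem lowestGramEig_sub_le_of_norm_sq_le [CompleteSpace ℋ] {w : Fin M → ℋ} {κ : ℝ} (hv0 : v ≠ 0)
    (hκ : κ < lowestGramEig 𝕜 v) (hker : ∀ x, synthesis 𝕜 v x = 0 → synthesis 𝕜 w x = 0)
    (hle : ∀ x, ‖synthesis 𝕜 v x‖ ^ 2 ≤ ‖synthesis 𝕜 w x‖ ^ 2 + κ * ‖x‖ ^ 2) :
    lowestGramEig 𝕜 v - κ ≤ lowestGramEig 𝕜 w := by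
  have hv := isLowerFrameBound_lowestGramEig (𝕜 := 𝕜) v
  refine (hv.sub_of_norm_sq_le hker hle).le_lowestGramEig ?_
  rintro rfl
  exact hv0 (hv.eq_zero (fun x => by simpa [synthesis_apply] using hle x) hκ)

end GramSpectrum

section Certificate

variable [CompleteSpace ℋ] {M : ℕ} {P : ProjValuedMeasure 𝕜 ℋ} {S T : Set ℝ} {v : Fin M → ℋ}
  {Ea Eb : ℝ}

theorem gramRank_restrictTo_le (P : ProjValuedMeasure 𝕜 ℋ) (S : Set ℝ) (v : Fin M → ℋ) :
    gramRank 𝕜 (restrictTo P S v) ≤ gramRank 𝕜 v := by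
  have : FiniteDimensional 𝕜 (Submodule.span 𝕜 (Set.range v)) :=
    FiniteDimensional.span_of_finite 𝕜 (Set.finite_range v)
  have h := Submodule.finrank_map_le (P.proj S : ℋ →ₗ[𝕜] ℋ) (Submodule.span 𝕜 (Set.range v))
  rw [Submodule.map_span, ← Set.range_comp] at h
  rw [gramRank_eq, gramRank_eq]
  exact h

theorem gramEig_one_restrictTo_mono (hS : MeasurableSet S) (hT : MeasurableSet T) (hST : S ⊆ T) :
    gramEig 𝕜 (restrictTo P S v) 1 ≤ gramEig 𝕜 (restrictTo P T v) 1 := by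
  refine gramEig_one_le (gramEig_nonneg _ _) fun x => ?_
  refine le_trans ?_ (norm_synthesis_sq_le_gramEig_one_mul _ x)
  rw [synthesis_restrictTo, synthesis_restrictTo]
  exact P.norm_sq_mono hS hT hST _

theorem gramEig_one_restrictTo_le (hS : MeasurableSet S) :
    gramEig 𝕜 (restrictTo P S v) 1 ≤ (specMeasure P v).real S := by
  rw [specMeasure_real_apply P v hS]
  exact gramEig_one_le_sum_norm_sq _

theorem specMeasure_real_le (hS : MeasurableSet S) :
    (specMeasure P v).real S ≤ gramRank 𝕜 v * gramEig 𝕜 (restrictTo P S v) 1 := by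
  rw [specMeasure_real_apply P v hS]
  refine (sum_norm_sq_le (𝕜 := 𝕜) (restrictTo P S v)).trans ?_
  gcongr
  · exact gramEig_nonneg _ _
  · exact gramRank_restrictTo_le P S v

/-- `λ_m(V²) - λ_1((V S)²)` with `m` the rank of `V²`: the denominator of the certificate for the
part `S` of the spectrum. It is `upperGap` for `S = [E_b, ∞)` and `lowerGap` for
`S = (-∞, E_a]`. -/
noncomputable def spectralGap (P : ProjValuedMeasure 𝕜 ℋ) (S : Set ℝ) (v : Fin M → ℋ) : ℝ :=
  lowestGramEig 𝕜 v - gramEig 𝕜 (restrictTo P S v) 1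

theorem isLowerFrameBound_spectralGap (P : ProjValuedMeasure 𝕜 ℋ) (S : Set ℝ) (v : Fin M → ℋ) :
    IsLowerFrameBound 𝕜 v (spectralGap P S v) :=
  (isLowerFrameBound_lowestGramEig v).mono (sub_le_self _ (gramEig_nonneg _ _))

/-- The spectral weight of `S` is certified to be harmless: the quotient of `|α|²(S)` by the
spectral gap is well defined and lies in `[0, 1]`, here stated without division. -/
structure HasCertifiedGap (P : ProjValuedMeasure 𝕜 ℋ) (S : Set ℝ) (v : Fin M → ℋ) : Prop where
  pos : 0 < spectralGap P S v
  real_le : (specMeasure P v).real S ≤ spectralGap P S v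

theorem hasCertifiedGap_iff (hS : MeasurableSet S) :
    HasCertifiedGap P S v ↔ spectralGap P S v ≠ 0 ∧
      (specMeasure P v).real S / spectralGap P S v ∈ Set.Icc (0 : ℝ) 1 := by
  have hT : 0 ≤ (specMeasure P v).real S := measureReal_nonneg
  constructor
  · rintro ⟨hpos, hle⟩
    exact ⟨hpos.ne', div_nonneg hT hpos.le, (div_le_one hpos).2 hle⟩
  · rintro ⟨hne, h0, h1⟩
    have hpos : 0 < spectralGap P S v := by
      refine hne.lt_of_le' (le_of_not_gt fun hneg => ?_)
      have hT0 : (specMeasure P v).real S ≤ 0 := by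
        by_contra! hT0
        exact h0.not_gt (div_neg_of_pos_of_neg hT0 hneg)
      have hle := (gramEig_one_restrictTo_le (P := P) (v := v) hS).trans hT0
      exact hneg.not_ge (sub_nonneg.2 (hle.trans (lowestGramEig_nonneg v)))
    exact ⟨hpos, (div_le_one hpos).1 h1⟩

namespace HasCertifiedGap

theorem ne_zero (h : HasCertifiedGap P S v) : v ≠ 0 :=
  (lowestGramEig_pos_iff (𝕜 := 𝕜)).1 ((gramEig_nonneg _ _).trans_lt (sub_pos.1 h.pos))

theorem spectralGap_le_lowestGramEig (h : HasCertifiedGap P S v) (hS : MeasurableSet S)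
    (hT : MeasurableSet T) (hTS : Tᶜ ⊆ S) :
    spectralGap P S v ≤ lowestGramEig 𝕜 (restrictTo P T v) := by
  refine lowestGramEig_sub_le_of_norm_sq_le v h.ne_zero (sub_pos.1 h.pos) (fun x hx => ?_)
    fun x => ?_
  · rw [synthesis_restrictTo, hx, map_zero]
  · rw [synthesis_restrictTo, ← P.norm_sq_add_norm_sq_compl hT (synthesis 𝕜 v x)]
    gcongr
    refine (P.norm_sq_mono hT.compl hS hTS _).trans ?_
    rw [← synthesis_restrictTo]
    exact norm_synthesis_sq_le_gramEig_one_mul _ x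

theorem setLIntegral_inv_lowestGramEig_le_one (h : HasCertifiedGap P S v) (hS : MeasurableSet S)
    {R : ℝ → Set ℝ} (hR : ∀ E, MeasurableSet (R E)) (hRS : ∀ E ∈ S, (R E)ᶜ ⊆ S) :
    ∫⁻ E in S, (ENNReal.ofReal (lowestGramEig 𝕜 (restrictTo P (R E) v)))⁻¹ ∂specMeasure P v ≤
      1 := by
  calc ∫⁻ E in S, (ENNReal.ofReal (lowestGramEig 𝕜 (restrictTo P (R E) v)))⁻¹ ∂specMeasure P v
      ≤ ∫⁻ _ in S, (ENNReal.ofReal (spectralGap P S v))⁻¹ ∂specMeasure P v :=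
        setLIntegral_mono' hS fun E hE => ENNReal.inv_le_inv.2 <|
          ENNReal.ofReal_le_ofReal (h.spectralGap_le_lowestGramEig hS (hR E) (hRS E hE))
    _ = (ENNReal.ofReal (spectralGap P S v))⁻¹ * specMeasure P v S := setLIntegral_const _ _
    _ ≤ (ENNReal.ofReal (spectralGap P S v))⁻¹ * ENNReal.ofReal (spectralGap P S v) := by
        rw [← ofReal_measureReal (μ := specMeasure P v)]
        gcongr
        exact h.real_le
    _ ≤ 1 := ENNReal.inv_mul_le_one _

theorem of_noise_le (hS : MeasurableSet S) (hSc : S ⊆ (Set.Ioo Ea Eb)ᶜ) (hv0 : v ≠ 0)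
    (h : ((gramRank 𝕜 v : ℝ) + 1) * gramEig 𝕜 (noise P Ea Eb v) 1 ≤ lowestGramEig 𝕜 v) :
    HasCertifiedGap P S v := by
  have hrank : (1 : ℝ) ≤ gramRank 𝕜 v := by exact_mod_cast gramRank_pos_iff.2 hv0
  have hpos := (lowestGramEig_pos_iff (𝕜 := 𝕜)).2 hv0
  have hS0 := gramEig_nonneg (𝕜 := 𝕜) (restrictTo P S v) 1
  have hSN : gramEig 𝕜 (restrictTo P S v) 1 ≤ gramEig 𝕜 (noise P Ea Eb v) 1 := by
    rw [noise_eq_restrictTo]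
    exact gramEig_one_restrictTo_mono hS measurableSet_Ioo.compl hSc
  have hle : ((gramRank 𝕜 v : ℝ) + 1) * gramEig 𝕜 (restrictTo P S v) 1 ≤ lowestGramEig 𝕜 v :=
    (mul_le_mul_of_nonneg_left hSN (by positivity)).trans h
  constructor
  · rw [spectralGap, sub_pos]
    linarith [mul_le_mul_of_nonneg_right hrank hS0]
  · rw [spectralGap]
    linarith [specMeasure_real_le (P := P) (v := v) hS]

end HasCertifiedGap

theorem isCertifiable_iff :
    IsCertifiable P Ea Eb v ↔
      HasCertifiedGap P (Set.Ici Eb) v ∧ HasCertifiedGap P (Set.Iic Ea) v := by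
  constructor
  · rintro ⟨-, hupper, hupper', hlower, hlower'⟩
    exact ⟨(hasCertifiedGap_iff measurableSet_Ici).2 ⟨hupper, hupper'⟩,
      (hasCertifiedGap_iff measurableSet_Iic).2 ⟨hlower, hlower'⟩⟩
  · rintro ⟨hupper, hlower⟩
    obtain ⟨hne, hmem⟩ := (hasCertifiedGap_iff measurableSet_Ici).1 hupper
    obtain ⟨hne', hmem'⟩ := (hasCertifiedGap_iff measurableSet_Iic).1 hlower
    refine ⟨⟨?_, ?_⟩, hne, hmem, hne', hmem'⟩
    · refine hupper.setLIntegral_inv_lowestGramEig_le_one measurableSet_Ici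
        (fun _ => measurableSet_Iio) fun E hE => ?_
      rw [Set.compl_Iio]
      exact Set.Ici_subset_Ici.2 hE
    · refine hlower.setLIntegral_inv_lowestGramEig_le_one measurableSet_Iic
        (fun _ => measurableSet_Ioi) fun E hE => ?_
      rw [Set.compl_Ioi]
      exact Set.Iic_subset_Iic.2 hE

theorem isCertifiable_of_noise_le (hv0 : v ≠ 0)
    (h : ((gramRank 𝕜 v : ℝ) + 1) * gramEig 𝕜 (noise P Ea Eb v) 1 ≤ lowestGramEig 𝕜 v) :
    IsCertifiable P Ea Eb v :=
  isCertifiable_iff.2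
    ⟨.of_noise_le measurableSet_Ici (fun _ hE hE' => hE'.2.not_ge hE) hv0 h,
      .of_noise_le measurableSet_Iic (fun _ hE hE' => hE'.1.not_ge hE) hv0 h⟩

theorem lowestGramEig_le_of_proj_Ioo_eq_zero (hE : Ea < Eb) {y : ℋ}
    (hy : y ∈ Submodule.span 𝕜 (Set.range v)) (hy0 : y ≠ 0) (hPy : P.proj (Set.Ioo Ea Eb) y = 0) :
    lowestGramEig 𝕜 v ≤ gramEig 𝕜 (restrictTo P (Set.Iic Ea) v) 1 +
      gramEig 𝕜 (restrictTo P (Set.Ici Eb) v) 1 := by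
  obtain ⟨x, rfl⟩ := mem_span_range_iff_exists_synthesis.1 hy
  obtain ⟨z, hz, hle⟩ := isLowerFrameBound_lowestGramEig (𝕜 := 𝕜) v x
  rw [← hz] at hy0 hPy
  have hz0 : 0 < ‖z‖ ^ 2 := by
    have : z ≠ 0 := by
      rintro rfl
      exact hy0 (map_zero _)
    positivity
  have hsplit := P.norm_sq_add_norm_sq_compl (S := Set.Ioo Ea Eb) measurableSet_Ioo
    (synthesis 𝕜 v z)
  rw [hPy, P.norm_sq_compl_Ioo hE, norm_zero] at hsplit
  have hIic := norm_synthesis_sq_le_gramEig_one_mul (restrictTo P (Set.Iic Ea) v) z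
  have hIci := norm_synthesis_sq_le_gramEig_one_mul (restrictTo P (Set.Ici Eb) v) z
  rw [synthesis_restrictTo] at hIic hIci
  exact le_of_mul_le_mul_right (by linarith) hz0

theorem IsCertifiable.specMeasure_real_eq_of_proj_Ioo_eq_zero (h : IsCertifiable P Ea Eb v)
    (hE : Ea < Eb) {y : ℋ} (hy : y ∈ Submodule.span 𝕜 (Set.range v)) (hy0 : y ≠ 0)
    (hPy : P.proj (Set.Ioo Ea Eb) y = 0) :
    (specMeasure P v).real (Set.Ici Eb) = spectralGap P (Set.Ici Eb) v ∧
      (specMeasure P v).real (Set.Iic Ea) = spectralGap P (Set.Iic Ea) v := by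
  obtain ⟨⟨-, hupper⟩, -, hlower⟩ := isCertifiable_iff.1 h
  have hle := lowestGramEig_le_of_proj_Ioo_eq_zero hE hy hy0 hPy
  have hIci := gramEig_one_restrictTo_le (P := P) (v := v) (measurableSet_Ici (a := Eb))
  have hIic := gramEig_one_restrictTo_le (P := P) (v := v) (measurableSet_Iic (a := Ea))
  unfold spectralGap at *
  constructor <;> linarith

end Certificate

section Certified

variable [CompleteSpace ℋ] {M : ℕ} {H : ℋ →ₗ.[𝕜] ℋ} {P : ProjValuedMeasure 𝕜 ℋ} {Ea Eb : ℝ}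

theorem proj_mem_span_restrictTo (S : Set ℝ) {v : Fin M → ℋ} {y : ℋ}
    (hy : y ∈ Submodule.span 𝕜 (Set.range v)) :
    P.proj S y ∈ Submodule.span 𝕜 (Set.range (restrictTo P S v)) := by
  obtain ⟨x, rfl⟩ := mem_span_range_iff_exists_synthesis.1 hy
  exact mem_span_range_iff_exists_synthesis.2 ⟨x, synthesis_restrictTo P v S x⟩

theorem proj_eq_self_of_mem_span_restrictTo {S : Set ℝ} (hS : MeasurableSet S) {v : Fin M → ℋ}
    {y : ℋ} (hy : y ∈ Submodule.span 𝕜 (Set.range (restrictTo P S v))) : P.proj S y = y := by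
  obtain ⟨x, rfl⟩ := mem_span_range_iff_exists_synthesis.1 hy
  rw [synthesis_restrictTo, P.proj_proj_self hS]

theorem exists_mem_span_proj_eq_zero {S : Set ℝ} {v : Fin M → ℋ}
    (h : gramRank 𝕜 (restrictTo P S v) < gramRank 𝕜 v) :
    ∃ y ∈ Submodule.span 𝕜 (Set.range v), y ≠ 0 ∧ P.proj S y = 0 := by
  have : FiniteDimensional 𝕜 (Submodule.span 𝕜 (Set.range v)) :=
    FiniteDimensional.span_of_finite 𝕜 (Set.finite_range v)
  let f := (P.proj S : ℋ →ₗ[𝕜] ℋ).submoduleMap (Submodule.span 𝕜 (Set.range v))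
  have hf : LinearMap.ker f ≠ ⊥ := by
    refine LinearMap.ker_ne_bot_of_finrank_lt ?_
    rw [Submodule.map_span, ← Set.range_comp, ← gramRank_eq, ← gramRank_eq]
    exact h
  obtain ⟨y, hy, hy0⟩ := Submodule.exists_mem_ne_zero_of_ne_bot hf
  exact ⟨y, y.2, by simpa using hy0, congrArg Subtype.val hy⟩

theorem IsSpectralResolution.setIntegral_sub_const_eq_add (hP : IsSpectralResolution H P)
    (v : Fin M → H.domain) (S : Set ℝ) (b c : ℝ) :
    ∫ E in S, (E - c) ∂specMeasure P (fun l => (v l : ℋ)) =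
      ∫ E in S, (E - b) ∂specMeasure P (fun l => (v l : ℋ)) +
        (specMeasure P fun l => (v l : ℋ)).real S * (b - c) := by
  rw [← smul_eq_mul, ← setIntegral_const,
    ← integral_add (hP.integrable_sub_const v b).restrict (integrable_const _)]
  simp only [sub_add_sub_cancel]

namespace IsRitzBasis

variable {Z : Submodule 𝕜 ℋ} {n r : ℕ} {e : Fin n → H.domain} {μ : Fin n → ℝ}
  {w : Fin r → H.domain} {ν : Fin r → ℝ} {v : Fin M → H.domain} {g : ℝ}

/- When the spectral weight equals the frame bound, the inequality for one constant `c` is the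
inequality for all of them. -/
theorem sub_le_setIntegral_Ici_div_of_real_eq
    (he : IsRitzBasis H (Submodule.span 𝕜 (Set.range fun l => (v l : ℋ))) e μ)
    (hw : IsRitzBasis H Z w ν) (hP : IsSpectralResolution H P) (hE : Ea < Eb)
    (hZ : ∀ z ∈ Z, P.proj (Set.Ioo Ea Eb) z = z)
    (hvZ : ∀ y ∈ Submodule.span 𝕜 (Set.range fun l => (v l : ℋ)), P.proj (Set.Ioo Ea Eb) y ∈ Z)
    (hv : IsLowerFrameBound 𝕜 (fun l => (v l : ℋ)) g) (hg : 0 < g)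
    (hgT : (specMeasure P fun l => (v l : ℋ)).real (Set.Ici Eb) = g) (i : Fin n) (c : ℝ) :
    μ i - c ≤ (∫ E in Set.Ici Eb, (E - c) ∂specMeasure P fun l => (v l : ℋ)) / g := by
  have h := he.mul_sub_le_setIntegral_Ici hw hP hE hZ hvZ hv hg.le i (Set.right_mem_Icc.2 hE.le)
    fun j _ => (hw.mem_Icc hP hZ j).2
  rw [le_div_iff₀' hg, hP.setIntegral_sub_const_eq_add v _ Eb, hgT]
  linarith

theorem setIntegral_Iic_div_le_sub_of_real_eq
    (he : IsRitzBasis H (Submodule.span 𝕜 (Set.range fun l => (v l : ℋ))) e μ)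
    (hw : IsRitzBasis H Z w ν) (hP : IsSpectralResolution H P) (hE : Ea < Eb)
    (hZ : ∀ z ∈ Z, P.proj (Set.Ioo Ea Eb) z = z)
    (hvZ : ∀ y ∈ Submodule.span 𝕜 (Set.range fun l => (v l : ℋ)), P.proj (Set.Ioo Ea Eb) y ∈ Z)
    (hv : IsLowerFrameBound 𝕜 (fun l => (v l : ℋ)) g) (hg : 0 < g)
    (hgT : (specMeasure P fun l => (v l : ℋ)).real (Set.Iic Ea) = g) (hrn : r ≤ n) (i : Fin n)
    (c : ℝ) :
    (∫ E in Set.Iic Ea, (E - c) ∂specMeasure P fun l => (v l : ℋ)) / g ≤ μ i - c := by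
  have h := he.setIntegral_Iic_le_mul_sub hw hP hE hZ hvZ hv hg.le hrn i
    (Set.left_mem_Icc.2 hE.le) fun j _ => (hw.mem_Icc hP hZ j).1
  rw [div_le_iff₀' hg, hP.setIntegral_sub_const_eq_add v _ Ea, hgT]
  linarith

end IsRitzBasis

theorem IsCertifiable.genEig_sub_bounds (hH : IsSelfAdjoint H) (hP : IsSpectralResolution H P)
    (hE : Ea < Eb) {v : Fin M → H.domain} (hcert : IsCertifiable P Ea Eb fun l => (v l : ℋ))
    {i : ℕ} (hi : i < gramRank 𝕜 fun l => (v l : ℋ)) :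
    genEig hH v (i + 1) - genEig hH (signal hP Ea Eb v) (i + 1) ≤
        (∫ E in Set.Ici Eb, (E - genEig hH (signal hP Ea Eb v) (i + 1))
          ∂specMeasure P (fun l => (v l : ℋ))) /
          spectralGap P (Set.Ici Eb) (fun l => (v l : ℋ)) ∧
      (∫ E in Set.Iic Ea, (E - genEig hH (signal hP Ea Eb v) (i + 1))
          ∂specMeasure P (fun l => (v l : ℋ))) /
          spectralGap P (Set.Iic Ea) (fun l => (v l : ℋ)) ≤
        genEig hH v (i + 1) - genEig hH (signal hP Ea Eb v) (i + 1) := by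
  obtain ⟨hupper, hlower⟩ := isCertifiable_iff.1 hcert
  obtain ⟨e, he⟩ := exists_isRitzBasis_genEig hH v
  obtain ⟨w, hw⟩ := exists_isRitzBasis_genEig hH (signal hP Ea Eb v)
  have hZ : ∀ z ∈ Submodule.span 𝕜 (Set.range fun l => (signal hP Ea Eb v l : ℋ)),
      P.proj (Set.Ioo Ea Eb) z = z := fun z hz =>
    proj_eq_self_of_mem_span_restrictTo measurableSet_Ioo (v := fun l => (v l : ℋ)) hz
  have hvZ : ∀ y ∈ Submodule.span 𝕜 (Set.range fun l => (v l : ℋ)), P.proj (Set.Ioo Ea Eb) y ∈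
      Submodule.span 𝕜 (Set.range fun l => (signal hP Ea Eb v l : ℋ)) := fun y hy =>
    proj_mem_span_restrictTo (Set.Ioo Ea Eb) hy
  have hrank := gramRank_restrictTo_le P (Set.Ioo Ea Eb) fun l => (v l : ℋ)
  have hv (S : Set ℝ) := isLowerFrameBound_spectralGap P S fun l => (v l : ℋ)
  rcases lt_or_ge i (gramRank 𝕜 fun l => (signal hP Ea Eb v l : ℋ)) with hir | hir
  · exact ⟨he.sub_le_setIntegral_Ici_div hw hP hE hZ hvZ (hv _) hupper.pos ⟨i, hi⟩ ⟨i, hir⟩ rfl,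
      he.setIntegral_Iic_div_le_sub hw hP hE hZ hvZ (hv _) hlower.pos hrank ⟨i, hi⟩ ⟨i, hir⟩ rfl⟩
  · obtain ⟨y, hy, hy0, hPy⟩ := exists_mem_span_proj_eq_zero (P := P) (S := Set.Ioo Ea Eb)
      (v := fun l => (v l : ℋ)) (hir.trans_lt hi)
    obtain ⟨hIci, hIic⟩ := hcert.specMeasure_real_eq_of_proj_Ioo_eq_zero hE hy hy0 hPy
    exact ⟨he.sub_le_setIntegral_Ici_div_of_real_eq hw hP hE hZ hvZ (hv _) hupper.pos hIci
        ⟨i, hi⟩ _,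
      he.setIntegral_Iic_div_le_sub_of_real_eq hw hP hE hZ hvZ (hv _) hlower.pos hIic hrank
        ⟨i, hi⟩ _⟩

end Certified

section Refined

namespace Diagonalizes

variable {M : ℕ} {v : Fin M → ℋ} {U : Matrix (Fin M) (Fin M) 𝕜}

theorem inner_synthesis_col (hU : Diagonalizes v U) (i j : Fin M) :
    inner 𝕜 (synthesis 𝕜 v (WithLp.toLp 2 (U.col i))) (synthesis 𝕜 v (WithLp.toLp 2 (U.col j))) =
      if i = j then (gramEig 𝕜 v (i + 1) : 𝕜) else 0 := by
  have h := congrFun₂ hU.2 i j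
  rw [Matrix.diagonal_apply, Matrix.mul_assoc] at h
  rw [← h, synthesis_apply, synthesis_apply, ← star_dotProduct_gram_mulVec]
  rfl

theorem norm_synthesis_col_sq (hU : Diagonalizes v U) (j : Fin M) :
    ‖synthesis 𝕜 v (WithLp.toLp 2 (U.col j))‖ ^ 2 = gramEig 𝕜 v (j + 1) := by
  rw [← inner_self_eq_norm_sq (𝕜 := 𝕜), hU.inner_synthesis_col, if_pos rfl, RCLike.ofReal_re]

theorem norm_col (hU : Diagonalizes v U) (j : Fin M) :
    ‖(WithLp.toLp 2 (U.col j) : EuclideanSpace 𝕜 (Fin M))‖ = 1 := by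
  have h := congrFun₂ (Matrix.mem_unitaryGroup_iff'.1 hU.1) j j
  rw [Matrix.one_apply_eq] at h
  rw [← pow_eq_one_iff_of_nonneg (norm_nonneg _) two_ne_zero, ← inner_self_eq_norm_sq (𝕜 := 𝕜),
    EuclideanSpace.inner_toLp_toLp, dotProduct_comm, ← RCLike.one_re (K := 𝕜), ← h]
  rfl

end Diagonalizes

theorem isRitzBasis_eigenSubspace {H : ℋ →ₗ.[𝕜] ℋ} {Ea Eb : ℝ} {d : ℕ} (hd : 0 < d)
    (hdim : Module.finrank 𝕜 (eigenSubspace H Ea Eb) = d) {φ : Fin d → H.domain} {lam : Fin d → ℝ}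
    (hφ : Orthonormal 𝕜 fun i => (φ i : ℋ)) (hHφ : ∀ i, H (φ i) = (lam i : 𝕜) • (φ i : ℋ))
    (hlam : ∀ i, lam i ∈ Set.Ioo Ea Eb) (hanti : Antitone lam) :
    IsRitzBasis H (eigenSubspace H Ea Eb) φ lam := by
  have : FiniteDimensional 𝕜 (eigenSubspace H Ea Eb) :=
    FiniteDimensional.of_finrank_pos (hdim ▸ hd)
  refine .of_finrank_eq hφ (fun i => ?_) hdim (fun i j => ?_) hanti
  · exact Submodule.subset_span ⟨φ i, lam i, hlam i, hHφ i, rfl⟩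
  · rw [hHφ, inner_smul_right, orthonormal_iff_ite.1 hφ, mul_ite, mul_one, mul_zero]

variable [CompleteSpace ℋ] {M : ℕ} {ε : ℝ}

theorem gramEig_detectedDim_le (v : Fin M → ℋ) (j : Fin (detectedDim 𝕜 v ε)) :
    gramEig 𝕜 v (detectedDim 𝕜 v ε) ≤ gramEig 𝕜 v (j + 1) := by
  have hle := detectedDim_le (𝕜 := 𝕜) v ε
  have h := gramEig_antitone (𝕜 := 𝕜) v (a := j.castLE hle)
    (b := ⟨detectedDim 𝕜 v ε - 1, (Nat.sub_one_lt_of_lt j.pos).trans_le hle⟩)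
    (Fin.le_def.2 (Nat.le_sub_one_of_lt j.2))
  simpa [Nat.sub_add_cancel j.pos] using h

theorem le_gramEig_detectedDim (v : Fin M → ℋ) (h : 0 < detectedDim 𝕜 v ε) :
    ε ≤ gramEig 𝕜 v (detectedDim 𝕜 v ε) := by
  have hle := detectedDim_le (𝕜 := 𝕜) v ε
  have hlt := (lt_detectedDim_iff v ε ⟨detectedDim 𝕜 v ε - 1, by omega⟩).1 (Nat.sub_one_lt h.ne')
  simpa only [Nat.sub_add_cancel h] using hlt

theorem coe_refined {H : ℋ →ₗ.[𝕜] ℋ} (v : Fin M → H.domain) (U : Matrix (Fin M) (Fin M) 𝕜) (ε : ℝ)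
    (j : Fin (detectedDim 𝕜 (fun l => (v l : ℋ)) ε)) :
    (refined v U ε j : ℋ) = synthesis 𝕜 (fun l => (v l : ℋ))
      (WithLp.toLp 2 (U.col (j.castLE (detectedDim_le _ _)))) := by
  simp [refined, synthesis_apply]

namespace Diagonalizes

variable {H : ℋ →ₗ.[𝕜] ℋ} {v : Fin M → H.domain} {U : Matrix (Fin M) (Fin M) 𝕜}

theorem pairwise_inner_refined_eq_zero (hU : Diagonalizes (fun l => (v l : ℋ)) U) :
    Pairwise fun i j => inner 𝕜 (refined v U ε i : ℋ) (refined v U ε j : ℋ) = 0 := by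
  intro i j hij
  simp only [coe_refined, hU.inner_synthesis_col]
  exact if_neg fun h => hij (Fin.castLE_injective _ h)

theorem norm_refined_sq (hU : Diagonalizes (fun l => (v l : ℋ)) U)
    (j : Fin (detectedDim 𝕜 (fun l => (v l : ℋ)) ε)) :
    ‖(refined v U ε j : ℋ)‖ ^ 2 = gramEig 𝕜 (fun l => (v l : ℋ)) (j + 1) := by
  rw [coe_refined, hU.norm_synthesis_col_sq, Fin.val_castLE]

theorem isLowerFrameBound_refined (hU : Diagonalizes (fun l => (v l : ℋ)) U) :
    IsLowerFrameBound 𝕜 (fun j => (refined v U ε j : ℋ))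
      (gramEig 𝕜 (fun l => (v l : ℋ)) (detectedDim 𝕜 (fun l => (v l : ℋ)) ε)) :=
  .of_pairwise_orthogonal hU.pairwise_inner_refined_eq_zero fun j =>
    (gramEig_detectedDim_le _ j).trans_eq (hU.norm_refined_sq j).symm

theorem gramRank_refined (hU : Diagonalizes (fun l => (v l : ℋ)) U) (hε : 0 < ε) :
    gramRank 𝕜 (fun j => (refined v U ε j : ℋ)) = detectedDim 𝕜 (fun l => (v l : ℋ)) ε := by
  have hne (j : Fin (detectedDim 𝕜 (fun l => (v l : ℋ)) ε)) : (refined v U ε j : ℋ) ≠ 0 := by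
    have hpos : 0 < ‖(refined v U ε j : ℋ)‖ ^ 2 := by
      rw [hU.norm_refined_sq]
      exact hε.trans_le ((lt_detectedDim_iff _ ε (j.castLE (detectedDim_le _ _))).1 j.2)
    exact norm_ne_zero_iff.1 (pow_ne_zero_iff two_ne_zero |>.1 hpos.ne')
  rw [gramRank_eq, finrank_span_eq_card
    (linearIndependent_of_ne_zero_of_inner_eq_zero hne hU.pairwise_inner_refined_eq_zero),
    Fintype.card_fin]

theorem norm_noise_refined_sq_le {P : ProjValuedMeasure 𝕜 ℋ} {Ea Eb : ℝ}
    (hU : Diagonalizes (fun l => (v l : ℋ)) U)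
    (j : Fin (detectedDim 𝕜 (fun l => (v l : ℋ)) ε)) :
    ‖noise P Ea Eb (fun j => (refined v U ε j : ℋ)) j‖ ^ 2 ≤
      gramEig 𝕜 (noise P Ea Eb fun l => (v l : ℋ)) 1 := by
  have h := norm_synthesis_sq_le_gramEig_one_mul (noise P Ea Eb fun l => (v l : ℋ))
    (WithLp.toLp 2 (U.col (j.castLE (detectedDim_le _ _))))
  rw [hU.norm_col, one_pow, mul_one] at h
  rw [noise_eq_restrictTo, synthesis_restrictTo, ← coe_refined] at h
  rw [noise_eq_restrictTo, noise_eq_restrictTo]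
  exact h

end Diagonalizes

theorem Diagonalizes.genEig_refined_sub_bounds {H : ℋ →ₗ.[𝕜] ℋ}
    {P : ProjValuedMeasure 𝕜 ℋ} {Ea Eb : ℝ} {v : Fin M → H.domain} {U : Matrix (Fin M) (Fin M) 𝕜}
    (hU : Diagonalizes (fun l => (v l : ℋ)) U) (hH : IsSelfAdjoint H)
    (hP : IsSpectralResolution H P) (hE : Ea < Eb)
    (hε : gramEig 𝕜 (noise P Ea Eb fun l => (v l : ℋ)) 1 < ε)
    (hran : eigenSubspace H Ea Eb = (P.proj (Set.Ioo Ea Eb)).range) {d : ℕ}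
    (hd : d = detectedDim 𝕜 (fun l => (v l : ℋ)) ε)
    (hdim : d = Module.finrank 𝕜 (eigenSubspace H Ea Eb))
    {φ : Fin d → H.domain} {lam : Fin d → ℝ} (hφ : Orthonormal 𝕜 fun i => (φ i : ℋ))
    (hHφ : ∀ i, H (φ i) = (lam i : 𝕜) • (φ i : ℋ)) (hlam : ∀ i, lam i ∈ Set.Ioo Ea Eb)
    (hanti : Antitone lam) (i : Fin d) :
    genEig hH (refined v U ε) (i + 1) - lam i ≤
        (∫ E in Set.Ici Eb, (E - lam i) ∂specMeasure P (fun j => (refined v U ε j : ℋ))) /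
          (gramEig 𝕜 (fun l => (v l : ℋ)) d -
            gramEig 𝕜 (noise P Ea Eb fun l => (v l : ℋ)) 1) ∧
      (∫ E in Set.Iic Ea, (E - lam i) ∂specMeasure P (fun j => (refined v U ε j : ℋ))) /
          (gramEig 𝕜 (fun l => (v l : ℋ)) d -
            gramEig 𝕜 (noise P Ea Eb fun l => (v l : ℋ)) 1) ≤
        genEig hH (refined v U ε) (i + 1) - lam i := by
  obtain ⟨e, he⟩ := exists_isRitzBasis_genEig hH (refined v U ε)
  have hw := isRitzBasis_eigenSubspace i.pos hdim.symm hφ hHφ hlam hanti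
  have hN := gramEig_nonneg (𝕜 := 𝕜) (noise P Ea Eb fun l => (v l : ℋ)) 1
  have hrank := (hU.gramRank_refined (hN.trans_lt hε)).trans hd.symm
  have hg : 0 < gramEig 𝕜 (fun l => (v l : ℋ)) d -
      gramEig 𝕜 (noise P Ea Eb fun l => (v l : ℋ)) 1 :=
    sub_pos.2 (hε.trans_le (hd ▸ le_gramEig_detectedDim _ (hd ▸ i.pos)))
  have hv : IsLowerFrameBound 𝕜 (fun j => (refined v U ε j : ℋ))
      (gramEig 𝕜 (fun l => (v l : ℋ)) d -
        gramEig 𝕜 (noise P Ea Eb fun l => (v l : ℋ)) 1) := by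
    rw [hd]
    exact hU.isLowerFrameBound_refined.mono (sub_le_self _ hN)
  have hZ : ∀ z ∈ eigenSubspace H Ea Eb, P.proj (Set.Ioo Ea Eb) z = z := by
    rw [hran]
    rintro _ ⟨x, rfl⟩
    exact P.proj_proj_self measurableSet_Ioo x
  have hvZ : ∀ y ∈ Submodule.span 𝕜 (Set.range fun j => (refined v U ε j : ℋ)),
      P.proj (Set.Ioo Ea Eb) y ∈ eigenSubspace H Ea Eb := fun y _ => by
    rw [hran]
    exact ⟨y, rfl⟩
  exact ⟨he.sub_le_setIntegral_Ici_div hw hP hE hZ hvZ hv hg ⟨i, hrank ▸ i.2⟩ i rfl,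
    he.setIntegral_Iic_div_le_sub hw hP hE hZ hvZ hv hg hrank.ge ⟨i, hrank ▸ i.2⟩ i rfl⟩

end Refined

end GEP

open GEP in
theorem mainTheorem8_general {𝕜 ℋ : Type*} [RCLike 𝕜] [NormedAddCommGroup ℋ]
    [InnerProductSpace 𝕜 ℋ] [CompleteSpace ℋ] (H : ℋ →ₗ.[𝕜] ℋ) (hH : IsSelfAdjoint H)
    (P : ProjValuedMeasure 𝕜 ℋ) (hP : IsSpectralResolution H P)
    (Ea Eb : ℝ) (hE : Ea < Eb) {M : ℕ} (v : Fin M → H.domain) :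
    (IsCertifiable P Ea Eb (fun l => (v l : ℋ)) →
      ∀ i : ℕ, 1 ≤ i → i ≤ gramRank 𝕜 (fun l => (v l : ℋ)) →
        IntegrableOn (fun E => E - genEig hH (signal hP Ea Eb v) i) (Set.Ici Eb)
          (specMeasure P fun l => (v l : ℋ)) ∧
        IntegrableOn (fun E => E - genEig hH (signal hP Ea Eb v) i) (Set.Iic Ea)
          (specMeasure P fun l => (v l : ℋ)) ∧
        genEig hH v i - genEig hH (signal hP Ea Eb v) i ≤
          (∫ E in Set.Ici Eb, (E - genEig hH (signal hP Ea Eb v) i)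
            ∂specMeasure P (fun l => (v l : ℋ))) /
            (gramEig 𝕜 (fun l => (v l : ℋ)) (gramRank 𝕜 fun l => (v l : ℋ)) -
              gramEig 𝕜 (restrictTo P (Set.Ici Eb) fun l => (v l : ℋ)) 1) ∧
        (∫ E in Set.Iic Ea, (E - genEig hH (signal hP Ea Eb v) i)
            ∂specMeasure P (fun l => (v l : ℋ))) /
            (gramEig 𝕜 (fun l => (v l : ℋ)) (gramRank 𝕜 fun l => (v l : ℋ)) -
              gramEig 𝕜 (restrictTo P (Set.Iic Ea) fun l => (v l : ℋ)) 1) ≤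
          genEig hH v i - genEig hH (signal hP Ea Eb v) i) ∧
    (v ≠ 0 →
      ((gramRank 𝕜 (fun l => (v l : ℋ)) : ℝ) + 1) *
          gramEig 𝕜 (noise P Ea Eb fun l => (v l : ℋ)) 1 ≤
        gramEig 𝕜 (fun l => (v l : ℋ)) (gramRank 𝕜 fun l => (v l : ℋ)) →
      IsCertifiable P Ea Eb fun l => (v l : ℋ)) ∧
    (∀ (ε : ℝ) (U : Matrix (Fin M) (Fin M) 𝕜) (m : ℕ),
      gramEig 𝕜 (noise P Ea Eb fun l => (v l : ℋ)) 1 < ε →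
      Diagonalizes (fun l => (v l : ℋ)) U →
      eigenSubspace H Ea Eb = (P.proj (Set.Ioo Ea Eb)).range →
      m = detectedDim 𝕜 (fun l => (v l : ℋ)) ε →
      m = Module.finrank 𝕜 (eigenSubspace H Ea Eb) →
      (∀ (φ : Fin m → H.domain) (lam : Fin m → ℝ),
        Orthonormal 𝕜 (fun i => (φ i : ℋ)) →
        (∀ i, H (φ i) = (lam i : 𝕜) • (φ i : ℋ)) →
        (∀ i, lam i ∈ Set.Ioo Ea Eb) → Antitone lam →
        ∀ i : Fin m,
          IntegrableOn (fun E => E - lam i) (Set.Ici Eb)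
            (specMeasure P fun j => (refined v U ε j : ℋ)) ∧
          IntegrableOn (fun E => E - lam i) (Set.Iic Ea)
            (specMeasure P fun j => (refined v U ε j : ℋ)) ∧
          genEig hH (refined v U ε) (i + 1) - lam i ≤
            (∫ E in Set.Ici Eb, (E - lam i)
              ∂specMeasure P (fun j => (refined v U ε j : ℋ))) /
              (gramEig 𝕜 (fun l => (v l : ℋ)) m -
                gramEig 𝕜 (noise P Ea Eb fun l => (v l : ℋ)) 1) ∧
          (∫ E in Set.Iic Ea, (E - lam i)
              ∂specMeasure P (fun j => (refined v U ε j : ℋ))) /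
              (gramEig 𝕜 (fun l => (v l : ℋ)) m -
                gramEig 𝕜 (noise P Ea Eb fun l => (v l : ℋ)) 1) ≤
            genEig hH (refined v U ε) (i + 1) - lam i) ∧
      (((specMeasure P fun j => (refined v U ε j : ℋ)).real (Set.Iic Ea) +
          (specMeasure P fun j => (refined v U ε j : ℋ)).real (Set.Ici Eb) : ℝ) : 𝕜) =
        (gram 𝕜 (noise P Ea Eb fun j => (refined v U ε j : ℋ))).trace ∧
      (specMeasure P fun j => (refined v U ε j : ℋ)).real (Set.Iic Ea) +
          (specMeasure P fun j => (refined v U ε j : ℋ)).real (Set.Ici Eb) ≤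
        m * gramEig 𝕜 (noise P Ea Eb fun l => (v l : ℋ)) 1) := by
  refine ⟨fun hcert i hi1 hi => ?_, fun hv hnoise => ?_,
    fun ε U m hε hU hran hd hdim => ⟨fun φ lam hφ hHφ hlam hanti i => ?_, ?_, ?_⟩⟩
  · obtain ⟨k, rfl⟩ := Nat.exists_eq_add_of_le' hi1
    exact ⟨(hP.integrable_sub_const v _).integrableOn, (hP.integrable_sub_const v _).integrableOn,
      hcert.genEig_sub_bounds hH hP hE hi⟩
  · exact isCertifiable_of_noise_le
      (fun h => hv (funext fun l => Subtype.ext (congrFun h l))) hnoise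
  · exact ⟨(hP.integrable_sub_const _ _).integrableOn, (hP.integrable_sub_const _ _).integrableOn,
      hU.genEig_refined_sub_bounds hH hP hE hε hran hd hdim hφ hHφ hlam hanti i⟩
  · rw [trace_gram, specMeasure_real_Iic_add_Ici P _ hE]
  · rw [specMeasure_real_Iic_add_Ici P _ hE, hd]
    simpa using Finset.sum_le_card_nsmul Finset.univ _ _ fun j _ => hU.norm_noise_refined_sq_le j

theorem mainTheorem8 {𝕜 ℋ : Type*} [RCLike 𝕜] [NormedAddCommGroup ℋ] [InnerProductSpace 𝕜 ℋ]
    [CompleteSpace ℋ] (H : ℋ →ₗ.[𝕜] ℋ) (hH : IsSelfAdjoint H)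
    (P : GEP.ProjValuedMeasure 𝕜 ℋ) (hP : GEP.IsSpectralResolution H P)
    (Ea Eb : ℝ) (hE : Ea < Eb) {M : ℕ} (v : Fin M → H.domain) :
    -- the integrated spectral inequalities for a certifiable signal
    (GEP.IsCertifiable P Ea Eb (fun l => (v l : ℋ)) →
      ∀ i : ℕ, 1 ≤ i → i ≤ GEP.gramRank 𝕜 (fun l => (v l : ℋ)) →
        MeasureTheory.IntegrableOn (fun E => E - GEP.genEig hH (GEP.signal hP Ea Eb v) i)
          (Set.Ici Eb) (GEP.specMeasure P (fun l => (v l : ℋ))) ∧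
        MeasureTheory.IntegrableOn (fun E => E - GEP.genEig hH (GEP.signal hP Ea Eb v) i)
          (Set.Iic Ea) (GEP.specMeasure P (fun l => (v l : ℋ))) ∧
        GEP.genEig hH v i - GEP.genEig hH (GEP.signal hP Ea Eb v) i ≤
          (∫ E in Set.Ici Eb, (E - GEP.genEig hH (GEP.signal hP Ea Eb v) i)
            ∂GEP.specMeasure P (fun l => (v l : ℋ))) /
            (GEP.gramEig 𝕜 (fun l => (v l : ℋ)) (GEP.gramRank 𝕜 (fun l => (v l : ℋ))) -
              GEP.gramEig 𝕜 (GEP.restrictTo P (Set.Ici Eb) (fun l => (v l : ℋ))) 1) ∧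
        (∫ E in Set.Iic Ea, (E - GEP.genEig hH (GEP.signal hP Ea Eb v) i)
            ∂GEP.specMeasure P (fun l => (v l : ℋ))) /
            (GEP.gramEig 𝕜 (fun l => (v l : ℋ)) (GEP.gramRank 𝕜 (fun l => (v l : ℋ))) -
              GEP.gramEig 𝕜 (GEP.restrictTo P (Set.Iic Ea) (fun l => (v l : ℋ))) 1) ≤
          GEP.genEig hH v i - GEP.genEig hH (GEP.signal hP Ea Eb v) i) ∧
    -- the sufficient condition for being a certifiable signal
    (v ≠ 0 →
      ((GEP.gramRank 𝕜 (fun l => (v l : ℋ)) : ℝ) + 1) *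
          GEP.gramEig 𝕜 (GEP.noise P Ea Eb (fun l => (v l : ℋ))) 1 ≤
        GEP.gramEig 𝕜 (fun l => (v l : ℋ)) (GEP.gramRank 𝕜 (fun l => (v l : ℋ))) →
      GEP.IsCertifiable P Ea Eb (fun l => (v l : ℋ))) ∧
    -- the guarantee for the refined guess vectors
    (∀ (ε : ℝ) (U : Matrix (Fin M) (Fin M) 𝕜) (m : ℕ),
      GEP.gramEig 𝕜 (GEP.noise P Ea Eb (fun l => (v l : ℋ))) 1 < ε →
      GEP.Diagonalizes (fun l => (v l : ℋ)) U →
      GEP.eigenSubspace H Ea Eb = (P.proj (Set.Ioo Ea Eb)).range →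
      m = GEP.detectedDim 𝕜 (fun l => (v l : ℋ)) ε →
      m = Module.finrank 𝕜 (GEP.eigenSubspace H Ea Eb) →
      ((m : ℝ) + 1) * GEP.gramEig 𝕜 (GEP.noise P Ea Eb (fun l => (v l : ℋ))) 1 ≤
        GEP.gramEig 𝕜 (fun l => (v l : ℋ)) m →
      (∀ (φ : Fin m → H.domain) (lam : Fin m → ℝ),
        Orthonormal 𝕜 (fun i => (φ i : ℋ)) →
        (∀ i, H (φ i) = (lam i : 𝕜) • (φ i : ℋ)) →
        (∀ i, lam i ∈ Set.Ioo Ea Eb) → Antitone lam →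
        ∀ i : Fin m,
          MeasureTheory.IntegrableOn (fun E => E - lam i) (Set.Ici Eb)
            (GEP.specMeasure P (fun j => (GEP.refined v U ε j : ℋ))) ∧
          MeasureTheory.IntegrableOn (fun E => E - lam i) (Set.Iic Ea)
            (GEP.specMeasure P (fun j => (GEP.refined v U ε j : ℋ))) ∧
          GEP.genEig hH (GEP.refined v U ε) (i + 1) - lam i ≤
            (∫ E in Set.Ici Eb, (E - lam i)
              ∂GEP.specMeasure P (fun j => (GEP.refined v U ε j : ℋ))) /
              (GEP.gramEig 𝕜 (fun l => (v l : ℋ)) m -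
                GEP.gramEig 𝕜 (GEP.noise P Ea Eb (fun l => (v l : ℋ))) 1) ∧
          (∫ E in Set.Iic Ea, (E - lam i)
              ∂GEP.specMeasure P (fun j => (GEP.refined v U ε j : ℋ))) /
              (GEP.gramEig 𝕜 (fun l => (v l : ℋ)) m -
                GEP.gramEig 𝕜 (GEP.noise P Ea Eb (fun l => (v l : ℋ))) 1) ≤
            GEP.genEig hH (GEP.refined v U ε) (i + 1) - lam i) ∧
      (((GEP.specMeasure P (fun j => (GEP.refined v U ε j : ℋ))).real (Set.Iic Ea) +
          (GEP.specMeasure P (fun j => (GEP.refined v U ε j : ℋ))).real (Set.Ici Eb) : ℝ) : 𝕜) =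
        (Matrix.gram 𝕜
          (GEP.noise P Ea Eb (fun j => (GEP.refined v U ε j : ℋ)))).trace ∧
      (GEP.specMeasure P (fun j => (GEP.refined v U ε j : ℋ))).real (Set.Iic Ea) +
          (GEP.specMeasure P (fun j => (GEP.refined v U ε j : ℋ))).real (Set.Ici Eb) ≤
        m * GEP.gramEig 𝕜 (GEP.noise P Ea Eb (fun l => (v l : ℋ))) 1) := by
  obtain ⟨h1, h2, h3⟩ := mainTheorem8_general H hH P hP Ea Eb hE v
  exact ⟨h1, h2, fun ε U m hε hU hran hd hdim _ => h3 ε U m hε hU hran hd hdim⟩
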